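/- \textbf{Definitions.} Consider $\mathbb{C}[[b]]$-modules $E$ endowed with a $\mathbb{C}$-linear endomorphism $a$ such that $a\,S = S\,a + b^2 S'$ for all $S\in\mathbb{C}[[b]]$; submodules, quotients, direct sums and morphisms are understood to be compatible with both $\mathbb{C}[[b]]$ and $a$. Such an $E$ is an \emph{(a,b)-module} if it is free of finite rank over $\mathbb{C}[[b]]$; it has a \emph{simple pole} if $aE\subset bE$, and it is \emph{regular} if it embeds in a simple pole (a,b)-module. A submodule $F\subset E$ is \emph{normal} if $F\cap bE=bF$. For $\nu\in\mathbb{C}$ let $E_\nu=\mathbb{C}[[b]]\,e$ be the rank $1$ module with $a e=\nu\, b e$. For a finite set $\Lambda\subset\mathbb{Q}\cap\,]0,1]$, an integer $N\ge 0$ and a finite dimensional complex vector space $V$, let $$\Xi_\Lambda^{(N)}\otimes V=\bigoplus_{r\in\Lambda}\bigoplus_{j=0}^N\mathbb{C}[[b]]\,s^{r-1}(\mathrm{Log}\,s)^j\otimes V,$$ where $a$ is multiplication by $s$ and $b$ is the primitive in $s$ without constant. A \emph{fresco} is a module isomorphic to the submodule generated by one element of some $\Xi_\Lambda^{(N)}\otimes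 V$. A \emph{Jordan--H\"older (J-H.) sequence} of $E$ is a sequence $0=F_0\subset F_1\subset\dots\subset F_k=E$ of normal submodules with $F_j/F_{j-1}$ of rank $1$; when $F_j/F_{j-1}\simeq E_{\lambda_j}$ for $1\le j\le k$, the $\lambda_1,\dots,\lambda_k$ are its associated numbers. An (a,b)-module is \emph{semi-simple} if it embeds in a finite direct sum of regular (a,b)-modules of rank $1$. The \emph{semi-simple part} $S_1(E)$ of a fresco $E$ is the submodule of $E$ made of (equivalently, generated by) the elements $x\in E$ for which the submodule generated by $x$ is semi-simple. \textbf{Statement.} Let $E$ be a fresco, let $\lambda_1,\dots,\lambda_k$ be the numbers associated to any J-H. sequence of $E$, and let $\mu_1,\dots,\mu_d$ be the numbers associated to any J-H. sequence of $S_1(E)$. Then: (1) for each $j\in[1,k]$, there exists a normal submodule of rank $1$ of $E$ isomorphic to $E_{\lambda_j+j-1}$ if and only if there exists $i\in[1,d]$ with $\lambda_j+j-1=\mu_i+i-1$; (2) this gives all isomorphism classes of normal submodules of rank $1$ of $E$: each normal submodule of rank $1$ of $E$ is isomorphic to $E_{\lambda_j+j-1}$ for some $j\in[1,k]$ such that $\lambda_j+j-1=\mu_i+i-1$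 for some $i\in[1,d]$. -/

import Mathlib

/-- The ring `ℂ[[b]]`; the variable `b` is `PowerSeries.X`. -/
abbrev Cb : Type := PowerSeries ℂ

/-- The element `b` of `ℂ[[b]]`. -/
noncomputable abbrev bb : Cb := PowerSeries.X

/-- The derivative `S ↦ S'` on `ℂ[[b]]`. -/
noncomputable abbrev bderiv (S : Cb) : Cb := PowerSeries.derivative ℂ S

/-- An action of `a` on a `ℂ[[b]]`-module: an additive map with `a S = S a + b² S'` for every
`S ∈ ℂ[[b]]`. Constants `S` have `S' = 0`, so `a` is `ℂ`-linear; for `S = b` the relation reads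
`a b - b a = b²`. -/
class ABAction (E : Type*) [AddCommGroup E] [Module Cb E] where
  a : E →+ E
  a_smul : ∀ (S : Cb) (x : E), a (S • x) = S • a x + (bb ^ 2 * bderiv S) • x

/-- Isomorphism: a `ℂ[[b]]`-linear bijection that commutes with `a`. -/
def ABIso (E F : Type*) [AddCommGroup E] [Module Cb E] [ABAction E]
    [AddCommGroup F] [Module Cb F] [ABAction F] : Prop :=
  ∃ e : E ≃ₗ[Cb] F, ∀ x, e (ABAction.a x) = ABAction.a (e x)

/-- `E` embeds into `F`: there is an injective `ℂ[[b]]`-linear map that commutes with `a`. -/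
def ABEmbeds (E F : Type*) [AddCommGroup E] [Module Cb E] [ABAction E]
    [AddCommGroup F] [Module Cb F] [ABAction F] : Prop :=
  ∃ f : E →ₗ[Cb] F, Function.Injective f ∧ ∀ x, f (ABAction.a x) = ABAction.a (f x)

/-- An (a,b)-module: the underlying `ℂ[[b]]`-module is free of finite rank. -/
def IsABModule (E : Type*) [AddCommGroup E] [Module Cb E] [ABAction E] : Prop :=
  Module.Free Cb E ∧ Module.Finite Cb E

/-- Simple pole: `a E ⊆ b E`. -/
def IsSimplePole (E : Type*) [AddCommGroup E] [Module Cb E] [ABAction E] : Prop :=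
  ∀ x : E, ∃ y : E, ABAction.a x = bb • y

/-- A regular (a,b)-module: one that embeds into a simple pole (a,b)-module. -/
def IsRegularAB (E : Type*) [AddCommGroup E] [Module Cb E] [ABAction E] : Prop :=
  IsABModule E ∧ ∃ (G : Type) (_ : AddCommGroup G) (_ : Module Cb G) (_ : ABAction G),
    IsABModule G ∧ IsSimplePole G ∧ ABEmbeds E G

/-- The direct sum of finitely many modules (as a product), with `a` acting componentwise. -/
instance ABAction.instPi {ι : Type*} (M : ι → Type*) [∀ i, AddCommGroup (M i)]
    [∀ i, Module Cb (M i)] [∀ i, ABAction (M i)] : ABAction (∀ i, M i) where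
  a :=
    { toFun := fun x i => ABAction.a (x i)
      map_zero' := by funext i; simp
      map_add' := by intro x y; funext i; simp }
  a_smul S x := by
    funext i
    exact ABAction.a_smul S (x i)

/-- A semi-simple (a,b)-module: an (a,b)-module that embeds into a finite direct sum of regular
(a,b)-modules of rank 1. -/
def IsSemisimpleAB (E : Type*) [AddCommGroup E] [Module Cb E] [ABAction E] : Prop :=
  IsABModule E ∧
  ∃ (n : ℕ) (M : Fin n → Type) (_ : ∀ i, AddCommGroup (M i)) (_ : ∀ i, Module Cb (M i))
    (_ : ∀ i, ABAction (M i)),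
    (∀ i, IsRegularAB (M i) ∧ Module.finrank Cb (M i) = 1) ∧ ABEmbeds E (∀ i, M i)

/-- Submodules: `ℂ[[b]]`-submodules that are stable under `a`. -/
structure ABSubmodule (E : Type*) [AddCommGroup E] [Module Cb E] [ABAction E] extends
    Submodule Cb E where
  a_mem : ∀ x ∈ toSubmodule, ABAction.a x ∈ toSubmodule

namespace ABSubmodule

variable {E : Type*} [AddCommGroup E] [Module Cb E] [ABAction E]

instance instCoeSort : CoeSort (ABSubmodule E) (Type _) := ⟨fun F => F.toSubmodule⟩

/-- The restriction of `a` to a submodule. -/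
instance instABAction (F : ABSubmodule E) : ABAction F.toSubmodule where
  a :=
    { toFun := fun x => ⟨ABAction.a (x : E), F.a_mem x x.2⟩
      map_zero' := by ext; simp
      map_add' := by intro x y; ext; simp }
  a_smul S x := by
    ext
    exact ABAction.a_smul S (x : E)

/-- The action of `a` on the quotient by a submodule. -/
noncomputable instance instABActionQuotient (F : ABSubmodule E) : ABAction (E ⧸ F.toSubmodule) where
  a := QuotientAddGroup.map F.toSubmodule.toAddSubgroup F.toSubmodule.toAddSubgroup
    ABAction.a (fun x hx => F.a_mem x hx)
  a_smul S x := by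
    induction x using Submodule.Quotient.induction_on with
    | H x => exact congrArg (Submodule.Quotient.mk (p := F.toSubmodule)) (ABAction.a_smul S x)

/-- For submodules `F`, `G` of `E`, the submodule `F ∩ G` of the module `G`. -/
noncomputable def restrict (F G : ABSubmodule E) : ABSubmodule G where
  toSubmodule := F.toSubmodule.comap G.toSubmodule.subtype
  a_mem x hx := F.a_mem (x : E) hx

/-- The smallest submodule that contains the set `s`. -/
noncomputable def generate (s : Set E) : ABSubmodule E where
  toSubmodule := sInf {p | s ⊆ p ∧ ∀ x ∈ p, ABAction.a x ∈ p}
  a_mem x hx := by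
    rw [Submodule.mem_sInf] at hx ⊢
    exact fun p hp => hp.2 x (hx p hp)

/-- `F` is normal in `E`: `F ∩ b E = b F`. -/
def IsNormal (F : ABSubmodule E) : Prop :=
  (F.toSubmodule : Set E) ∩ Set.range (fun x : E => bb • x) =
    (fun x : E => bb • x) '' (F.toSubmodule : Set E)

end ABSubmodule

/-- The rank 1 module `E_ν`, free over `ℂ[[b]]` on a generator `e` with `a e = ν b e`.
The series `S` stands for `S e`. -/
def Elam (_ν : ℂ) : Type := Cb

namespace Elam

variable (ν : ℂ)

noncomputable instance instAddCommGroup : AddCommGroup (Elam ν) := inferInstanceAs (AddCommGroup Cb)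

noncomputable instance instModule : Module Cb (Elam ν) := inferInstanceAs (Module Cb Cb)

/-- The formula `a (S e) = (ν b S + b² S') e`. -/
noncomputable def act (S : Cb) : Cb := PowerSeries.C ν * bb * S + bb ^ 2 * bderiv S

theorem act_zero : act ν 0 = 0 := by simp [act]

theorem act_add (S T : Cb) : act ν (S + T) = act ν S + act ν T := by
  simp only [act, bderiv, map_add]
  ring

theorem act_mul (S T : Cb) : act ν (S * T) = S * act ν T + (bb ^ 2 * bderiv S) * T := by
  simp only [act, bderiv, Derivation.leibniz, smul_eq_mul]
  ring

noncomputable instance instABAction : ABAction (Elam ν) where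
  a := { toFun := act ν, map_zero' := act_zero ν, map_add' := act_add ν }
  a_smul := act_mul ν

end Elam

/-- The module `Ξ_Λ^{(N)} ⊗ ℂ^p` of asymptotic expansions
`∑ ℂ[[b]] s^{r-1} (Log s)^j ⊗ v_q` over `r ∈ Λ`, `0 ≤ j ≤ N`, `1 ≤ q ≤ p`, where `a` is the
multiplication by `s` and `b` the primitive without constant. An expansion is given by its
coefficients in `ℂ[[b]]` on the elements `e_{r,j} ⊗ v_q`, where `e_{r,j} = s^{r-1} (Log s)^j`. -/
def Xi (Λ : Finset ℚ) (N p : ℕ) : Type := Λ → Fin (N + 1) → Fin p → Cb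

namespace Xi

variable (Λ : Finset ℚ) (N p : ℕ)

noncomputable instance instAddCommGroup : AddCommGroup (Xi Λ N p) :=
  inferInstanceAs (AddCommGroup (Λ → Fin (N + 1) → Fin p → Cb))

noncomputable instance instModule : Module Cb (Xi Λ N p) :=
  inferInstanceAs (Module Cb (Λ → Fin (N + 1) → Fin p → Cb))

/-- The coefficient on `e_{r,j+1} ⊗ v_q`, which is zero for `j = N`. -/
noncomputable def next (f : Λ → Fin (N + 1) → Fin p → Cb) (r : Λ) (j : Fin (N + 1))
    (q : Fin p) : Cb :=
  if h : (j : ℕ) + 1 < N + 1 then f r ⟨(j : ℕ) + 1, h⟩ q else 0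

/-- As `s e_{r,j} = s^r (Log s)^j` is the primitive of `r e_{r,j} + j e_{r,j-1}`, one has
`a e_{r,j} = r b e_{r,j} + j b e_{r,j-1}`; with `a S = S a + b² S'` the coefficient of `a f`
on `e_{r,j}` is `r b f_{r,j} + b² f_{r,j}' + (j + 1) b f_{r,j+1}`. -/
noncomputable instance instABAction : ABAction (Xi Λ N p) where
  a :=
    { toFun := fun (f : Λ → Fin (N + 1) → Fin p → Cb) r j q =>
        PowerSeries.C (((r : ℚ) : ℂ)) * bb * f r j q + bb ^ 2 * bderiv (f r j q) +
          PowerSeries.C ((((j : ℕ) + 1 : ℕ)) : ℂ) * bb * next Λ N p f r j q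
      map_zero' := by
        funext r j q
        change PowerSeries.C (((r : ℚ) : ℂ)) * bb * (0 : Cb) + bb ^ 2 * bderiv (0 : Cb) +
          PowerSeries.C ((((j : ℕ) + 1 : ℕ)) : ℂ) * bb * next Λ N p (fun _ _ _ => 0) r j q = 0
        simp [next]
      map_add' := by
        intro (f : Λ → Fin (N + 1) → Fin p → Cb) (g : Λ → Fin (N + 1) → Fin p → Cb)
        funext r j q
        have hn : next Λ N p (f + g) r j q = next Λ N p f r j q + next Λ N p g r j q := by
          unfold next
          split_ifs <;> simp
        change PowerSeries.C (((r : ℚ) : ℂ)) * bb * (f r j q + g r j q) +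
            bb ^ 2 * bderiv (f r j q + g r j q) +
            PowerSeries.C ((((j : ℕ) + 1 : ℕ)) : ℂ) * bb * next Λ N p (f + g) r j q =
          (PowerSeries.C (((r : ℚ) : ℂ)) * bb * f r j q + bb ^ 2 * bderiv (f r j q) +
            PowerSeries.C ((((j : ℕ) + 1 : ℕ)) : ℂ) * bb * next Λ N p f r j q) +
          (PowerSeries.C (((r : ℚ) : ℂ)) * bb * g r j q + bb ^ 2 * bderiv (g r j q) +
            PowerSeries.C ((((j : ℕ) + 1 : ℕ)) : ℂ) * bb * next Λ N p g r j q)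
        rw [hn]
        simp only [bderiv, map_add]
        ring }
  a_smul := by
    intro S (f : Λ → Fin (N + 1) → Fin p → Cb)
    funext r j q
    have hn : next Λ N p (S • f) r j q = S * next Λ N p f r j q := by
      unfold next
      split_ifs <;> simp
    change PowerSeries.C (((r : ℚ) : ℂ)) * bb * (S * f r j q) +
        bb ^ 2 * bderiv (S * f r j q) +
        PowerSeries.C ((((j : ℕ) + 1 : ℕ)) : ℂ) * bb * next Λ N p (S • f) r j q =
      S * (PowerSeries.C (((r : ℚ) : ℂ)) * bb * f r j q + bb ^ 2 * bderiv (f r j q) +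
        PowerSeries.C ((((j : ℕ) + 1 : ℕ)) : ℂ) * bb * next Λ N p f r j q) +
      (bb ^ 2 * bderiv S) * f r j q
    rw [hn]
    simp only [bderiv, Derivation.leibniz, smul_eq_mul]
    ring

end Xi

/-- A fresco: a module isomorphic to the submodule generated by one element `φ` of
`Ξ_Λ^{(N)} ⊗ V`, for a finite set `Λ` of rationals in `]0,1]`, an integer `N ≥ 0` and a finite
dimensional complex vector space `V = ℂ^p`. -/
def IsFresco (E : Type*) [AddCommGroup E] [Module Cb E] [ABAction E] : Prop :=
  ∃ (Λ : Finset ℚ) (N p : ℕ) (φ : Xi Λ N p), (∀ r ∈ Λ, 0 < r ∧ r ≤ 1) ∧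
    ABIso E (ABSubmodule.generate {φ})

/-- The semi-simple part `S₁(E)`: the submodule made of (generated by) the elements `x` whose
cyclic submodule is semi-simple. -/
noncomputable def semisimplePart (E : Type*) [AddCommGroup E] [Module Cb E] [ABAction E] : ABSubmodule E :=
  ABSubmodule.generate {x : E | IsSemisimpleAB (ABSubmodule.generate {x})}

/-- `0 = F₀ ⊆ F₁ ⊆ ⋯ ⊆ F_k = E` is a Jordan-Hölder sequence of `E` whose associated numbers are
`lam 1, …, lam k`: the `F_j` are normal submodules and `F_j / F_{j-1}` is isomorphic to
`E_{lam j}` (so it has rank 1) for `1 ≤ j ≤ k`. -/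
structure IsJordanHolder {E : Type*} [AddCommGroup E] [Module Cb E] [ABAction E] (k : ℕ)
    (F : ℕ → ABSubmodule E) (lam : ℕ → ℂ) : Prop where
  bot : (F 0).toSubmodule = ⊥
  top : (F k).toSubmodule = ⊤
  mono : ∀ j ∈ Finset.Icc 1 k, (F (j - 1)).toSubmodule ≤ (F j).toSubmodule
  normal : ∀ j ≤ k, (F j).IsNormal
  quot : ∀ j ∈ Finset.Icc 1 k,
    ABIso (F j ⧸ ((F (j - 1)).restrict (F j)).toSubmodule) (Elam (lam j))

/-! Put `θ = b⁻¹a` on the module of asymptotic expansions. A fresco `E` of rank `k = n + 1` embeds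
there with a generator `e`. The span `W` of `e, θe, …, θⁿe` over `ℂ[[b]]` is `θ`-stable, and `E` is
the span of `e, bθe, …, bⁿθⁿe` (`range_eq_krylovLattice`). Descending a J-H. sequence and following
a generator of each term produces a monic `B` of degree `k` with roots `λ_j + j - k` and `B(θ)e ∈
bW` (`aeval_bernsteinPoly_mem`). So `B` is the minimal polynomial of `θ` on the cyclic space `W/bW`.

A normal submodule of rank 1 isomorphic to `E_ν` amounts to an `x ∈ E`, not in `bE`, with `θx = νx`.
Write `x = b^m y` with `y ∈ W` not in `bW`. Modulo `b`, the eigenvector `y` is a multiple of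
`Q(θ)e`, where `B = (X - (ν - m))Q`, so its coordinate on `θⁿe` is a unit. Then `b^m y ∈ E` forces
`m = n`, hence `ν - n` is a root of `B`, that is `ν = λ_j + j - 1` for some `j`
(`isRoot_of_eigenvector`).

The converse needs `θ` to be diagonalizable, that is, the absence of logarithms: then `Q(θ)e` can be
projected to a true eigenvector (`Xi.exists_eigenvector`). The derivation `∂/∂Log s` commutes with
`a`, and `S₁(E)` is its kernel in `E` (`mem_semisimplePart`). This kernel is again cyclic
(`exists_generates_ker`), so both directions apply to it. It contains every eigenvector, because a
module of rank 1 has no logarithms, and it is saturated for `b`. Hence the exponents of `E` are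
exactly the numbers `μ_i + i - 1`. -/

open Polynomial Pointwise

set_option linter.unusedSectionVars false

/-! ### Krylov modules of an Euler-type operator -/

section Krylov

variable {M : Type*} [AddCommGroup M] [Module Cb M] [Module ℂ M] [IsScalarTower ℂ Cb M]
  (θ : Module.End ℂ M)

/-- The Euler-type Leibniz rule `θ S = S θ + b S'`. -/
def IsEuler : Prop := ∀ (S : Cb) (x : M), θ (S • x) = S • θ x + (bb * bderiv S) • x

theorem C_smul_eq (c : ℂ) (x : M) : (PowerSeries.C c : Cb) • x = c • x := by
  have : (PowerSeries.C c : Cb) = c • (1 : Cb) := by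
    rw [PowerSeries.smul_eq_C_mul, mul_one]
  rw [this, smul_assoc, one_smul]

theorem bb_mul_bderiv_pow (n : ℕ) : bb * bderiv (bb ^ n) = (PowerSeries.C (n : ℂ) : Cb) * bb ^ n := by
  rw [bderiv, Derivation.leibniz_pow, PowerSeries.derivative_X]
  rcases n with _ | n
  · simp
  · simp only [Nat.add_sub_cancel, smul_eq_mul, mul_one, nsmul_eq_mul, map_natCast]
    ring

variable {θ}

theorem IsEuler.pow_smul (hθ : IsEuler θ) (n : ℕ) (x : M) :
    θ (bb ^ n • x) = bb ^ n • (θ x + (n : ℂ) • x) := by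
  rw [hθ, bb_mul_bderiv_pow, smul_add, mul_comm, mul_smul, C_smul_eq]

theorem IsEuler.bb_smul (hθ : IsEuler θ) (x : M) : θ (bb • x) = bb • (θ x + x) := by
  simpa using hθ.pow_smul 1 x

theorem IsEuler.stable_bb_smul (hθ : IsEuler θ) {W : Submodule Cb M} (hW : ∀ x ∈ W, θ x ∈ W) :
    ∀ x ∈ bb • W, θ x ∈ bb • W := by
  intro x hx
  obtain ⟨y, hy, rfl⟩ := Submodule.mem_smul_pointwise_iff_exists _ _ _ |>.1 hx
  rw [hθ.bb_smul]
  exact Submodule.smul_mem_pointwise_smul _ _ _ (W.add_mem (hW y hy) hy)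

theorem csmul_mem (W : Submodule Cb M) (c : ℂ) {x : M} (hx : x ∈ W) : c • x ∈ W := by
  rw [← C_smul_eq]
  exact W.smul_mem _ hx

theorem aeval_mem_of_stable {W : Submodule Cb M} (hW : ∀ x ∈ W, θ x ∈ W) (p : ℂ[X]) :
    ∀ x ∈ W, aeval θ p x ∈ W := by
  have hpow : ∀ n : ℕ, ∀ x ∈ W, (θ ^ n) x ∈ W := by
    intro n
    induction n with
    | zero => simp
    | succ n ih => intro x hx; rw [pow_succ']; exact hW _ (ih x hx)
  intro x hx
  rw [aeval_eq_sum_range, LinearMap.sum_apply]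
  exact W.sum_mem fun i _ => csmul_mem W _ (hpow i x hx)

variable (θ)

/-- The `ℂ[[b]]`-span of `e, θ e, …, θ^(n-1) e`. -/
noncomputable def krylov (e : M) (n : ℕ) : Submodule Cb M :=
  Submodule.span Cb (Set.range fun i : Fin n => (θ ^ (i : ℕ)) e)

/-- The `ℂ[[b]]`-span of `e, b θ e, …, b^(n-1) θ^(n-1) e`. -/
noncomputable def krylovLattice (e : M) (n : ℕ) : Submodule Cb M :=
  Submodule.span Cb (Set.range fun i : Fin n => bb ^ (i : ℕ) • (θ ^ (i : ℕ)) e)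

variable {θ} {e : M}

theorem pow_mem_krylov {i n : ℕ} (h : i < n) : (θ ^ i) e ∈ krylov θ e n :=
  Submodule.subset_span ⟨⟨i, h⟩, rfl⟩

theorem krylov_mono {m n : ℕ} (h : m ≤ n) : krylov θ e m ≤ krylov θ e n := by
  rw [krylov, Submodule.span_le]
  rintro _ ⟨i, rfl⟩
  exact pow_mem_krylov (i.2.trans_le h)

theorem IsEuler.mem_krylov_succ (hθ : IsEuler θ) {n : ℕ} {x : M} (hx : x ∈ krylov θ e n) :
    θ x ∈ krylov θ e (n + 1) := by
  induction hx using Submodule.span_induction with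
  | mem x h =>
    obtain ⟨i, rfl⟩ := h
    have := pow_mem_krylov (θ := θ) (e := e) (Nat.succ_lt_succ i.2)
    rwa [pow_succ'] at this
  | zero => simp
  | add x y _ _ hx hy => rw [map_add]; exact add_mem hx hy
  | smul a x h hx =>
    rw [hθ]
    exact add_mem (Submodule.smul_mem _ _ hx) (Submodule.smul_mem _ _ (krylov_mono n.le_succ h))

theorem aeval_eq_sum_fin {p : ℂ[X]} {n : ℕ} (hp : p.degree < n) :
    aeval θ p e = ∑ i : Fin n, (PowerSeries.C (p.coeff i) : Cb) • (θ ^ (i : ℕ)) e := by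
  rcases n with _ | n
  · have : p = 0 := by
      rw [← degree_eq_bot]
      simpa using hp
    simp [this]
  · have h : p.natDegree < n + 1 := by
      rcases eq_or_ne p 0 with rfl | h0
      · simp
      · exact (natDegree_lt_iff_degree_lt h0).2 hp
    rw [aeval_eq_sum_range' h, LinearMap.sum_apply, ← Fin.sum_univ_eq_sum_range
      (fun i => (p.coeff i • θ ^ i) e)]
    simp only [C_smul_eq, LinearMap.smul_apply]

theorem aeval_mem_krylov {p : ℂ[X]} {n : ℕ} (hp : p.degree < n) :
    aeval θ p e ∈ krylov θ e n := by
  rw [aeval_eq_sum_fin hp]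
  exact Submodule.sum_mem _ fun i _ => Submodule.smul_mem _ _ (pow_mem_krylov i.2)

theorem exists_coord_of_mem_krylov {n : ℕ} {x : M} (hx : x ∈ krylov θ e n) :
    ∃ h : Fin n → Cb, x = ∑ i, h i • (θ ^ (i : ℕ)) e := by
  obtain ⟨h, rfl⟩ := (Submodule.mem_span_range_iff_exists_fun Cb).1 hx
  exact ⟨h, rfl⟩

theorem exists_coord_of_mem_krylovLattice {n : ℕ} {x : M} (hx : x ∈ krylovLattice θ e n) :
    ∃ h : Fin n → Cb, x = ∑ i, (h i * bb ^ (i : ℕ)) • (θ ^ (i : ℕ)) e := by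
  obtain ⟨h, rfl⟩ := (Submodule.mem_span_range_iff_exists_fun Cb).1 hx
  exact ⟨h, by simp only [mul_smul]⟩

/-- The polynomial of degree `< n` with coefficients the constant terms of `h`. -/
noncomputable def constPoly {n : ℕ} (h : Fin n → Cb) : ℂ[X] :=
  ∑ i : Fin n, C (PowerSeries.constantCoeff (h i)) * X ^ (i : ℕ)

theorem degree_constPoly {n : ℕ} (h : Fin n → Cb) : (constPoly h).degree < n := by
  refine (degree_sum_le _ _).trans_lt ?_
  refine (Finset.sup_lt_iff (WithBot.bot_lt_coe n)).2 ?_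
  intro i _
  exact (degree_C_mul_X_pow_le _ _).trans_lt ((Nat.cast_lt (α := WithBot ℕ)).2 i.2)

theorem coeff_constPoly {n : ℕ} (h : Fin n → Cb) (i : Fin n) :
    (constPoly h).coeff i = PowerSeries.constantCoeff (h i) := by
  simp [constPoly, coeff_C_mul, coeff_X_pow, Fin.val_inj]

theorem sub_aeval_constPoly_mem {n : ℕ} (h : Fin n → Cb) :
    ∑ i, h i • (θ ^ (i : ℕ)) e - aeval θ (constPoly h) e ∈ bb • krylov θ e n := by
  rw [aeval_eq_sum_fin (degree_constPoly h), ← Finset.sum_sub_distrib]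
  refine Submodule.sum_mem _ fun i _ => ?_
  rw [← sub_smul, coeff_constPoly]
  obtain ⟨g, hg⟩ : (PowerSeries.X : Cb) ∣ h i - PowerSeries.C (PowerSeries.constantCoeff (h i)) := by
    rw [PowerSeries.X_dvd_iff]; simp
  rw [hg, mul_smul]
  exact Submodule.smul_mem_pointwise_smul _ _ _ (Submodule.smul_mem _ _ (pow_mem_krylov i.2))

/-- The classes of the `θ^i e` form a basis of `W/bW`, so no nonzero polynomial of degree below `n`
kills the class of `e`. -/
theorem eq_zero_of_aeval_mem {n : ℕ} (hli : LinearIndependent Cb fun i : Fin n => (θ ^ (i : ℕ)) e)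
    {p : ℂ[X]} (hp : p.degree < n) (h : aeval θ p e ∈ bb • krylov θ e n) : p = 0 := by
  obtain ⟨y, hy, hyp⟩ := (Submodule.mem_smul_pointwise_iff_exists _ _ _).1 h
  obtain ⟨g, rfl⟩ := exists_coord_of_mem_krylov hy
  rw [aeval_eq_sum_fin hp, Finset.smul_sum] at hyp
  simp only [← mul_smul] at hyp
  have key := hli.eq_coords_of_eq hyp
  ext i
  rcases lt_or_ge i n with hi | hi
  · have := congrArg PowerSeries.constantCoeff (key ⟨i, hi⟩)
    simpa using this.symm
  · rw [coeff_zero]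
    exact coeff_eq_zero_of_degree_lt (hp.trans_le (by exact_mod_cast hi))

/-- Since `B` is monic, `B(θ)e ∈ bW` puts `θ^k e` back into `W`. -/
theorem IsEuler.krylov_stable (hθ : IsEuler θ) {k : ℕ} {B : ℂ[X]} (hBm : B.Monic)
    (hBk : B.natDegree = k) (hB : aeval θ B e ∈ bb • krylov θ e k) :
    ∀ x ∈ krylov θ e k, θ x ∈ krylov θ e k := by
  have hb : bb • krylov θ e k ≤ krylov θ e k := by
    intro x hx
    obtain ⟨y, hy, rfl⟩ := (Submodule.mem_smul_pointwise_iff_exists _ _ _).1 hx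
    exact Submodule.smul_mem _ _ hy
  have hk : (θ ^ k) e ∈ krylov θ e k := by
    have hd : (B - X ^ k).degree < (k : WithBot ℕ) := by
      have := degree_sub_lt_left (p := B) (q := X ^ k) (by
        rw [degree_X_pow, degree_eq_natDegree hBm.ne_zero, hBk]) hBm.ne_zero
        (by rw [hBm.leadingCoeff, leadingCoeff_X_pow])
      rwa [degree_eq_natDegree hBm.ne_zero, hBk] at this
    have h1 := aeval_mem_krylov (θ := θ) (e := e) hd
    have h2 := sub_mem (hb hB) h1
    simpa using h2
  intro x hx
  induction hx using Submodule.span_induction with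
  | mem x h =>
    obtain ⟨i, rfl⟩ := h
    change θ ((θ ^ (i : ℕ)) e) ∈ _
    rw [← Module.End.mul_apply, ← pow_succ']
    rcases (Nat.succ_le_of_lt i.2).lt_or_eq with h | h
    · exact pow_mem_krylov h
    · rw [show (i : ℕ) + 1 = k from h]; exact hk
  | zero => simp
  | add x y _ _ hx hy => rw [map_add]; exact add_mem hx hy
  | smul a x h hx =>
    rw [hθ]
    exact add_mem (Submodule.smul_mem _ _ hx) (Submodule.smul_mem _ _ h)

/-- Eigenvectors of `θ` modulo `b` are multiples of `B / (X - ν)`. -/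
theorem eigenvector_mod_bb (hθ : IsEuler θ) {n : ℕ} {B : ℂ[X]} (hBm : B.Monic)
    (hBk : B.natDegree = n + 1) (hB : aeval θ B e ∈ bb • krylov θ e (n + 1))
    (hli : LinearIndependent Cb fun i : Fin (n + 1) => (θ ^ (i : ℕ)) e)
    {h : Fin (n + 1) → Cb} {x : M} (hx : x = ∑ i, h i • (θ ^ (i : ℕ)) e)
    (hx0 : x ∉ bb • krylov θ e (n + 1)) {ν : ℂ} (hν : θ x - ν • x ∈ bb • krylov θ e (n + 1)) :
    B.IsRoot ν ∧ PowerSeries.constantCoeff (h (Fin.last n)) ≠ 0 := by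
  set p := constPoly h with hp
  set W := krylov θ e (n + 1)
  have hst := hθ.stable_bb_smul (hθ.krylov_stable hBm hBk hB)
  have hxp : x - aeval θ p e ∈ bb • W := hx ▸ sub_aeval_constPoly_mem h
  have hp0 : p ≠ 0 := by
    intro h0
    rw [h0] at hxp
    exact hx0 (by simpa using hxp)
  set c := p.coeff n with hc
  -- `(X - ν)p` kills `e` modulo `bW` but may have degree `n + 1`. Subtracting `cB` lowers the
  -- degree, so independence gives `(X - ν)p = cB`, with `c` the top coefficient of `p`.
  have hdeg : ((X - C ν) * p - C c * B).degree < ((n + 1 : ℕ) : WithBot ℕ) := by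
    rw [degree_lt_iff_coeff_zero]
    intro m hm
    have hpm : p.coeff m = 0 :=
      coeff_eq_zero_of_degree_lt ((degree_constPoly h).trans_le (by exact_mod_cast hm))
    rcases hm.lt_or_eq with hlt | rfl
    · obtain ⟨m, rfl⟩ := Nat.exists_eq_succ_of_ne_zero (by omega : m ≠ 0)
      have h2 : p.coeff m = 0 :=
        coeff_eq_zero_of_degree_lt ((degree_constPoly h).trans_le (by
          exact_mod_cast (by omega : n + 1 ≤ m)))
      have h3 : B.coeff (m + 1) = 0 := coeff_eq_zero_of_natDegree_lt (by omega)
      simp [sub_mul, coeff_X_mul, h2, h3, hpm]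
    · have h3 : B.coeff (n + 1) = 1 := by rw [← hBk]; exact hBm
      simp [sub_mul, coeff_X_mul, h3, hpm, hc]
  have hz : (X - C ν) * p - C c * B = 0 := by
    refine eq_zero_of_aeval_mem hli hdeg ?_
    have e1 : aeval θ ((X - C ν) * p - C c * B) e =
        θ x - ν • x - (θ (x - aeval θ p e) - ν • (x - aeval θ p e)) - c • aeval θ B e := by
      simp [sub_mul, smul_sub]
      abel
    rw [e1]
    exact sub_mem (sub_mem hν (sub_mem (hst _ hxp) (csmul_mem _ _ hxp))) (csmul_mem _ _ hB)
  have hc0 : c ≠ 0 := by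
    intro h0
    rw [h0] at hz
    simp [hp0, X_sub_C_ne_zero] at hz
  refine ⟨?_, ?_⟩
  · have := congrArg (eval ν) hz
    simpa [hc0] using this
  · rw [← coeff_constPoly, Fin.val_last]
    exact hc0

variable [Module.IsTorsionFree Cb M]

theorem bb_pow_smul_injective (n : ℕ) : Function.Injective fun x : M => bb ^ n • x :=
  smul_right_injective M (pow_ne_zero n PowerSeries.X_ne_zero)

theorem krylovLattice_le (n : ℕ) : krylovLattice θ e n ≤ krylov θ e n := by
  rw [krylovLattice, Submodule.span_le]
  rintro _ ⟨i, rfl⟩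
  exact Submodule.smul_mem _ _ (pow_mem_krylov i.2)

theorem pow_smul_mem_krylovLattice {n : ℕ} {x : M} (hx : x ∈ krylov θ e (n + 1)) :
    bb ^ n • x ∈ krylovLattice θ e (n + 1) := by
  obtain ⟨h, rfl⟩ := exists_coord_of_mem_krylov hx
  rw [Finset.smul_sum]
  refine Submodule.sum_mem _ fun i _ => ?_
  rw [← mul_smul, show bb ^ n * h i = (h i * bb ^ (n - i)) * bb ^ (i : ℕ) by
    rw [mul_assoc, ← pow_add, Nat.sub_add_cancel (Nat.le_of_lt_succ i.2), mul_comm], mul_smul]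
  exact Submodule.smul_mem _ _ (Submodule.subset_span ⟨i, rfl⟩)

/-- Dividing `x` by the largest `b^m` possible inside `W` gives an eigenvector for `ν - m` whose
last coordinate is a unit. Since `b^m` times it lies in the lattice, `b^n` divides `b^m`. -/
theorem isRoot_of_eigenvector (hθ : IsEuler θ) {n : ℕ} {B : ℂ[X]} (hBm : B.Monic)
    (hBk : B.natDegree = n + 1) (hB : aeval θ B e ∈ bb • krylov θ e (n + 1))
    (hli : LinearIndependent Cb fun i : Fin (n + 1) => (θ ^ (i : ℕ)) e)
    {x : M} (hx : x ∈ krylovLattice θ e (n + 1)) (hx0 : x ∉ bb • krylovLattice θ e (n + 1))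
    {ν : ℂ} (hν : θ x = ν • x) : B.IsRoot (ν - n) := by
  set W := krylov θ e (n + 1)
  -- `b^n W` lies in the lattice, so a primitive `x` of the lattice is not in `b^(n+1) W`; this
  -- bounds `m` by `n`.
  have hnot : ¬ ∀ m ≤ n + 1, ∃ y ∈ W, x = bb ^ m • y := by
    intro hall
    obtain ⟨y, hy, rfl⟩ := hall (n + 1) le_rfl
    refine hx0 ?_
    rw [pow_succ', mul_smul]
    exact Submodule.smul_mem_pointwise_smul _ _ _ (pow_smul_mem_krylovLattice hy)
  have hex : ∃ m ≤ n, (∃ y ∈ W, x = bb ^ m • y) ∧ ¬ ∃ y ∈ W, x = bb ^ (m + 1) • y := by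
    by_contra! hcon
    refine hnot fun m => ?_
    induction m with
    | zero => exact fun _ => ⟨x, krylovLattice_le _ hx, by simp⟩
    | succ m ih =>
      intro hm
      obtain ⟨y, hy, hxy⟩ := ih (by omega)
      exact hcon m (by omega) ⟨y, hy, hxy⟩
  obtain ⟨m, hmn, ⟨y, hy, rfl⟩, hm⟩ := hex
  have hy0 : y ∉ bb • W := by
    intro h
    obtain ⟨z, hz, rfl⟩ := (Submodule.mem_smul_pointwise_iff_exists _ _ _).1 h
    exact hm ⟨z, hz, by rw [pow_succ, mul_smul]⟩
  have hyν : θ y = (ν - m) • y := by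
    rw [hθ.pow_smul, smul_comm] at hν
    have := bb_pow_smul_injective m hν
    rw [sub_smul, ← this]
    abel
  obtain ⟨h, hyh⟩ := exists_coord_of_mem_krylov hy
  obtain ⟨hroot, hlast⟩ := eigenvector_mod_bb hθ hBm hBk hB hli hyh hy0 (ν := ν - m)
    (by rw [hyν, sub_self]; exact zero_mem _)
  obtain ⟨g, hg⟩ := exists_coord_of_mem_krylovLattice hx
  rw [hyh, Finset.smul_sum] at hg
  simp only [← mul_smul] at hg
  have key := hli.eq_coords_of_eq hg (Fin.last n)
  simp only [Fin.val_last] at key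
  have hu : IsUnit (h (Fin.last n)) := by
    rw [PowerSeries.isUnit_iff_constantCoeff]; exact hlast.isUnit
  have hd : bb ^ n ∣ bb ^ m := by
    rw [← hu.dvd_mul_right, key]
    exact Dvd.intro_left _ rfl
  have hnm : n ≤ m := (pow_dvd_pow_iff PowerSeries.X_ne_zero PowerSeries.X_prime.not_isUnit).1 hd
  obtain rfl : m = n := le_antisymm hmn hnm
  exact hroot

/-- The unit coordinate of `y` on `θ^n e` shows that `b^n y` is primitive in the lattice. -/
theorem pow_smul_notMem_bb_krylovLattice (hθ : IsEuler θ) {n : ℕ} {B : ℂ[X]} (hBm : B.Monic)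
    (hBk : B.natDegree = n + 1) (hB : aeval θ B e ∈ bb • krylov θ e (n + 1))
    (hli : LinearIndependent Cb fun i : Fin (n + 1) => (θ ^ (i : ℕ)) e)
    {y : M} (hy : y ∈ krylov θ e (n + 1)) (hy0 : y ∉ bb • krylov θ e (n + 1))
    {ν : ℂ} (hν : θ y = ν • y) : bb ^ n • y ∉ bb • krylovLattice θ e (n + 1) := by
  intro hmem
  obtain ⟨u, hu, huy⟩ := (Submodule.mem_smul_pointwise_iff_exists _ _ _).1 hmem
  obtain ⟨h, rfl⟩ := exists_coord_of_mem_krylov hy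
  obtain ⟨g, rfl⟩ := exists_coord_of_mem_krylovLattice hu
  have hlast := (eigenvector_mod_bb hθ hBm hBk hB hli rfl hy0 (ν := ν)
    (by rw [hν, sub_self]; exact zero_mem _)).2
  rw [Finset.smul_sum, Finset.smul_sum] at huy
  simp only [← mul_smul] at huy
  have key := hli.eq_coords_of_eq huy (Fin.last n)
  simp only [Fin.val_last] at key
  have : h (Fin.last n) = bb * g (Fin.last n) := by
    apply mul_left_cancel₀ (pow_ne_zero n (PowerSeries.X_ne_zero (R := ℂ)))
    rw [← key]; ring
  rw [this] at hlast
  simp at hlast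

/-- One step of the factorization `∏ (a - λ_j b) T_j` of the annihilator of `e`. -/
theorem exists_step (hθ : IsEuler θ) {j : ℕ} {B : ℂ[X]} (hBk : B.natDegree = j) {c : ℂ}
    (hc : c ≠ 0) {w : M} (hw : w ∈ krylov θ e (j + 1)) {T : Cb}
    (hT : PowerSeries.constantCoeff T ≠ 0) (l : ℂ) :
    ∃ c' : ℂ, c' ≠ 0 ∧ ∃ w' ∈ krylov θ e (j + 2),
      bb • (θ (T • bb ^ j • (c • aeval θ B e + bb • w)) -
        l • (T • bb ^ j • (c • aeval θ B e + bb • w))) =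
      bb ^ (j + 1) • (c' • aeval θ ((X - C (l - j)) * B) e + bb • w') := by
  obtain ⟨g, hg⟩ : (PowerSeries.X : Cb) ∣ T - PowerSeries.C (PowerSeries.constantCoeff T) := by
    rw [PowerSeries.X_dvd_iff]; simp
  set t := PowerSeries.constantCoeff T
  have hBe : aeval θ B e ∈ krylov θ e (j + 1) :=
    aeval_mem_krylov (degree_le_natDegree.trans_lt (by rw [hBk]; exact_mod_cast j.lt_succ_self))
  -- Only the constant term `t` of `T` matters modulo `b`. The shift from `l` to `l - j` comes from
  -- commuting `θ` with `b^j`.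
  have hTz : T • (c • aeval θ B e + bb • w) =
      (t * c) • aeval θ B e + bb • (g • c • aeval θ B e + T • w) := by
    rw [eq_add_of_sub_eq hg]
    simp only [add_smul, smul_add, mul_smul, C_smul_eq]
    rw [smul_comm bb t w]
    simp only [smul_comm g bb w]
    abel
  set v := g • c • aeval θ B e + T • w with hv
  have hvm : v ∈ krylov θ e (j + 1) :=
    add_mem (Submodule.smul_mem _ _ (csmul_mem _ _ hBe)) (Submodule.smul_mem _ _ hw)
  refine ⟨t * c, mul_ne_zero hT hc, θ v + v + ((j : ℂ) - l) • v,
    add_mem (add_mem (hθ.mem_krylov_succ hvm) (krylov_mono (Nat.le_succ _) hvm))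
      (csmul_mem _ _ (krylov_mono (Nat.le_succ _) hvm)), ?_⟩
  rw [smul_comm T, hTz, hθ.pow_smul, smul_comm l, ← smul_sub, ← mul_smul, ← pow_succ']
  congr 1
  rw [map_add, hθ.bb_smul]
  simp only [map_mul, map_sub, aeval_X, aeval_C, Module.End.mul_apply, LinearMap.sub_apply,
    Module.algebraMap_end_apply, map_smul, smul_add, smul_sub, sub_smul, mul_smul,
    smul_comm _ bb, smul_comm l t, smul_comm l c, smul_comm (j : ℂ) t, smul_comm (j : ℂ) c]
  abel

/-- Here `w` may involve `θ^k e`, one power too many. Rewriting that power by means of `B(θ)e` turns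
the coefficient of `B(θ)e` into `c + bs`, still a unit. -/
theorem aeval_mem_of_add_eq_zero {k : ℕ} {B : ℂ[X]} (hBm : B.Monic) (hBk : B.natDegree = k)
    {c : ℂ} (hc : c ≠ 0) {w : M} (hw : w ∈ krylov θ e (k + 1))
    (h : c • aeval θ B e + bb • w = 0) : aeval θ B e ∈ bb • krylov θ e k := by
  obtain ⟨g, rfl⟩ := exists_coord_of_mem_krylov hw
  set s := g (Fin.last k)
  have hd : (B - X ^ k).degree < (k : WithBot ℕ) := by
    have := degree_sub_lt_left (p := B) (q := X ^ k) (by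
      rw [degree_X_pow, degree_eq_natDegree hBm.ne_zero, hBk]) hBm.ne_zero
      (by rw [hBm.leadingCoeff, leadingCoeff_X_pow])
    rwa [degree_eq_natDegree hBm.ne_zero, hBk] at this
  have h1 := aeval_mem_krylov (θ := θ) (e := e) hd
  have h2 : ∑ i : Fin k, g i.castSucc • (θ ^ (i : ℕ)) e ∈ krylov θ e k :=
    Submodule.sum_mem _ fun i _ => Submodule.smul_mem _ _ (pow_mem_krylov i.2)
  rw [Fin.sum_univ_castSucc] at h
  simp only [Fin.val_castSucc, Fin.val_last] at h
  have h3 : (θ ^ k) e = aeval θ B e - aeval θ (B - X ^ k) e := by simp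
  have h4 : (PowerSeries.C c + bb * s : Cb) • aeval θ B e =
      bb • (s • aeval θ (B - X ^ k) e - ∑ i : Fin k, g i.castSucc • (θ ^ (i : ℕ)) e) := by
    rw [h3] at h
    rw [add_smul, C_smul_eq, mul_smul, ← sub_eq_zero, ← h]
    simp only [smul_sub, smul_add]
    abel
  obtain ⟨u, hu⟩ : IsUnit (PowerSeries.C c + bb * s : Cb) := by
    rw [PowerSeries.isUnit_iff_constantCoeff]
    simpa using hc
  have h5 : aeval θ B e = (↑u⁻¹ : Cb) • (PowerSeries.C c + bb * s : Cb) • aeval θ B e := by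
    rw [← hu, ← mul_smul, Units.inv_mul, one_smul]
  rw [h5, h4]
  exact Submodule.smul_mem _ _ (Submodule.smul_mem_pointwise_smul _ _ _
    (sub_mem (Submodule.smul_mem _ _ h1) h2))

end Krylov

/-! ### Differential equations without power series solutions -/

/-- The constant term gives `c g₀² = 0`. Then `n gₙ` is `c` times a sum of products `gᵢ gₙ₋ᵢ`, each
with a factor already known to vanish. -/
theorem bb_mul_bderiv_eq_zero {g : Cb} {c : ℂ} (hc : c ≠ 0)
    (h : bb * bderiv g = PowerSeries.C c * g ^ 2) : g = 0 := by
  have h' : ∀ n : ℕ, (n : ℂ) * PowerSeries.coeff n g = c * PowerSeries.coeff n (g ^ 2) := by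
    intro n
    have := congrArg (PowerSeries.coeff n) h
    rw [PowerSeries.coeff_C_mul] at this
    rw [← this]
    rcases n with _ | n
    · simp
    · rw [mul_comm bb, PowerSeries.coeff_succ_mul_X, bderiv, PowerSeries.coeff_derivative]
      push_cast; ring
  ext n
  rw [map_zero]
  induction n using Nat.strong_induction_on with
  | _ n ih =>
    have hn := h' n
    rcases Nat.eq_zero_or_pos n with rfl | hpos
    · simpa [hc] using hn
    · have h0 := ih 0 hpos
      have : PowerSeries.coeff n (g ^ 2) = 0 := by
        rw [sq, PowerSeries.coeff_mul]
        refine Finset.sum_eq_zero fun p hp => ?_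
        have hp' := Finset.HasAntidiagonal.mem_antidiagonal.1 hp
        rcases Nat.eq_zero_or_pos p.1 with h1 | h1
        · rw [h1, h0, zero_mul]
        · rw [ih p.2 (by omega), mul_zero]
      rw [this, mul_zero] at hn
      exact (mul_eq_zero.1 hn).resolve_left (by exact_mod_cast hpos.ne')

/-- There is no logarithm in the fraction field of `ℂ[[b]]`. -/
theorem eq_zero_of_wronskian {y z : Cb} {c : ℂ} (hc : c ≠ 0)
    (h : bb * (bderiv z * y - bderiv y * z) + PowerSeries.C c * y ^ 2 = 0) : y = 0 := by
  by_contra hy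
  -- One of `z/y` and `y/z` is a power series `g`. In the first case `b g' = -c`, absurd at the
  -- constant term; in the second `b g' = c g²`.
  rcases ValuationRing.dvd_total y z with ⟨g, rfl⟩ | ⟨g, rfl⟩
  · have h1 : bb * bderiv g + PowerSeries.C c = 0 := by
      apply mul_right_cancel₀ (pow_ne_zero 2 hy)
      rw [zero_mul, ← h]
      simp only [bderiv, Derivation.leibniz, smul_eq_mul]
      ring
    have := congrArg PowerSeries.constantCoeff h1
    simp [hc] at this
  · have hz : z ≠ 0 := left_ne_zero_of_mul hy
    refine right_ne_zero_of_mul hy (bb_mul_bderiv_eq_zero hc ?_)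
    apply mul_right_cancel₀ (pow_ne_zero 2 hz)
    rw [← sub_eq_zero, ← neg_eq_zero, ← h]
    simp only [bderiv, Derivation.leibniz, smul_eq_mul]
    ring

/-! ### Operators on asymptotic expansions -/

namespace Xi

variable {Λ : Finset ℚ} {N p : ℕ}

noncomputable instance : Module ℂ (Xi Λ N p) :=
  inferInstanceAs (Module ℂ (Λ → Fin (N + 1) → Fin p → Cb))

instance : IsScalarTower ℂ Cb (Xi Λ N p) :=
  inferInstanceAs (IsScalarTower ℂ Cb (Λ → Fin (N + 1) → Fin p → Cb))

instance : Module.IsTorsionFree Cb (Xi Λ N p) :=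
  inferInstanceAs (Module.IsTorsionFree Cb (Λ → Fin (N + 1) → Fin p → Cb))

instance : Module.Free Cb (Xi Λ N p) :=
  inferInstanceAs (Module.Free Cb (Λ → Fin (N + 1) → Fin p → Cb))

instance : Module.Finite Cb (Xi Λ N p) :=
  inferInstanceAs (Module.Finite Cb (Λ → Fin (N + 1) → Fin p → Cb))

@[ext] theorem ext {f g : Xi Λ N p} (h : ∀ r j q, f r j q = g r j q) : f = g :=
  funext fun r => funext fun j => funext fun q => h r j q

@[simp] theorem add_apply (f g : Xi Λ N p) (r j q) : (f + g) r j q = f r j q + g r j q := rfl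
@[simp] theorem sub_apply (f g : Xi Λ N p) (r j q) : (f - g) r j q = f r j q - g r j q := rfl
@[simp] theorem smul_apply (S : Cb) (f : Xi Λ N p) (r j q) : (S • f) r j q = S * f r j q := rfl
@[simp] theorem csmul_apply (c : ℂ) (f : Xi Λ N p) (r j q) : (c • f) r j q = c • f r j q := rfl
@[simp] theorem zero_apply (r j q) : (0 : Xi Λ N p) r j q = 0 := rfl

theorem next_add (f g : Xi Λ N p) (r j q) :
    next Λ N p (f + g) r j q = next Λ N p f r j q + next Λ N p g r j q := by
  unfold next; split_ifs <;> simp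

theorem next_smul (S : Cb) (f : Xi Λ N p) (r j q) :
    next Λ N p (S • f) r j q = S * next Λ N p f r j q := by
  unfold next; split_ifs <;> simp

variable (Λ N p) in
/-- The derivation with respect to `Log s`. -/
noncomputable def logD : Xi Λ N p →ₗ[Cb] Xi Λ N p where
  toFun f := fun r j q => PowerSeries.C ((((j : ℕ) + 1 : ℕ)) : ℂ) * next Λ N p f r j q
  map_add' f g := by
    funext r j q
    change _ = PowerSeries.C _ * next Λ N p f r j q + PowerSeries.C _ * next Λ N p g r j q
    rw [next_add, mul_add]
  map_smul' S f := by
    funext r j q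
    change _ = S * (PowerSeries.C _ * next Λ N p f r j q)
    rw [next_smul]; ring

theorem logD_apply (f : Xi Λ N p) (r j q) :
    logD Λ N p f r j q = PowerSeries.C ((((j : ℕ) + 1 : ℕ)) : ℂ) * next Λ N p f r j q := rfl

variable (Λ N p) in
/-- The semi-simple part `s^(r-1) b^m ↦ (r + m) s^(r-1) b^m` of `b⁻¹ a`. -/
noncomputable def euler : Module.End ℂ (Xi Λ N p) where
  toFun f := fun r j q => PowerSeries.C (((r : ℚ) : ℂ)) * f r j q + bb * bderiv (f r j q)
  map_add' f g := by
    funext r j q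
    change _ = (PowerSeries.C _ * f r j q + bb * bderiv (f r j q)) +
      (PowerSeries.C _ * g r j q + bb * bderiv (g r j q))
    simp only [bderiv, map_add, add_apply]; ring
  map_smul' c f := by
    funext r j q
    change _ = c • (PowerSeries.C _ * f r j q + bb * bderiv (f r j q))
    simp only [bderiv, csmul_apply, Derivation.map_smul, smul_add, mul_smul_comm]

theorem euler_apply (f : Xi Λ N p) (r j q) :
    euler Λ N p f r j q = PowerSeries.C (((r : ℚ) : ℂ)) * f r j q + bb * bderiv (f r j q) := rfl

variable (Λ N p) in
/-- The operator `b⁻¹ a`. -/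
noncomputable def theta : Module.End ℂ (Xi Λ N p) := euler Λ N p + (logD Λ N p).restrictScalars ℂ

theorem theta_eq (f : Xi Λ N p) : theta Λ N p f = euler Λ N p f + logD Λ N p f := rfl

theorem a_eq (f : Xi Λ N p) : ABAction.a f = bb • theta Λ N p f := by
  ext1 r j q
  rw [theta_eq, smul_apply, add_apply, euler_apply, logD_apply]
  change PowerSeries.C (((r : ℚ) : ℂ)) * bb * f r j q + bb ^ 2 * bderiv (f r j q) +
          PowerSeries.C ((((j : ℕ) + 1 : ℕ)) : ℂ) * bb * next Λ N p f r j q = _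
  ring

theorem isEuler_theta : IsEuler (theta Λ N p) := by
  intro S f
  ext1 r j q
  simp only [theta_eq, map_smul, smul_apply, add_apply, euler_apply, bderiv, Derivation.leibniz,
    smul_eq_mul]
  ring

theorem logD_euler (f : Xi Λ N p) : logD Λ N p (euler Λ N p f) = euler Λ N p (logD Λ N p f) := by
  ext1 r j q
  rw [logD_apply, euler_apply, logD_apply]
  unfold next
  split_ifs
  · rw [euler_apply]
    simp only [bderiv, Derivation.leibniz, smul_eq_mul, PowerSeries.derivative_C]
    ring
  · simp

theorem logD_theta (f : Xi Λ N p) : logD Λ N p (theta Λ N p f) = theta Λ N p (logD Λ N p f) := by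
  rw [theta_eq, theta_eq, map_add, logD_euler]

theorem logD_a (f : Xi Λ N p) : logD Λ N p (ABAction.a f) = ABAction.a (logD Λ N p f) := by
  rw [a_eq, a_eq, map_smul, logD_theta]

theorem apply_eq_zero_of_logD {f : Xi Λ N p} (h : logD Λ N p f = 0) (r) {j : Fin (N + 1)}
    (hj : j ≠ 0) (q) : f r j q = 0 := by
  obtain ⟨i, rfl⟩ := Fin.exists_succ_eq.2 hj
  have := congrFun (congrFun (congrFun h r) i.castSucc) q
  rw [logD_apply] at this
  have hn : next Λ N p f r i.castSucc q = f r i.succ q := by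
    unfold next
    rw [dif_pos (by simp)]
    rfl
  rw [hn] at this
  refine (mul_eq_zero.1 this).resolve_left fun h0 => ?_
  have := congrArg PowerSeries.constantCoeff h0
  rw [PowerSeries.constantCoeff_C, map_zero] at this
  exact Nat.cast_ne_zero.2 (Nat.succ_ne_zero _) this

theorem logD_eq_zero_of_apply {f : Xi Λ N p} (h : ∀ r j q, j ≠ 0 → f r j q = 0) :
    logD Λ N p f = 0 := by
  ext1 r j q
  rw [logD_apply]
  unfold next
  split_ifs with hj
  · rw [h _ _ _ (fun h0 => Nat.succ_ne_zero _ (congrArg Fin.val h0))]; simp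
  · simp

/-- On the highest power of `Log s` that occurs, `a` acts as in rank 1, without a contribution from
above. -/
theorem exists_top {f : Xi Λ N p} {r j q} (h : f r j q ≠ 0) :
    ∃ i ≥ j, f r i q ≠ 0 ∧ next Λ N p f r i q = 0 := by
  classical
  obtain ⟨i, hi, hmax⟩ := Finset.exists_max_image (Finset.univ.filter fun i => f r i q ≠ 0) id
    ⟨j, by simpa using h⟩
  refine ⟨i, hmax j (by simpa using h), by simpa using hi, ?_⟩
  unfold next
  split_ifs with hlt
  · by_contra hne
    have := hmax ⟨i + 1, hlt⟩ (by simpa using hne)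
    simp only [id, Fin.le_def] at this
    omega
  · rfl

/-- If a logarithm occurred, the coefficients `y` and `z` of its two highest powers would have a
quotient with `b (z/y)'` a nonzero constant: eliminating `S` and `T` between their two equations
gives the relation of `eq_zero_of_wronskian`. -/
theorem logD_eq_zero_of_smul {x : Xi Λ N p} {S T : Cb} (hT : T ≠ 0)
    (h : T • ABAction.a x = S • x) : logD Λ N p x = 0 := by
  by_contra hD
  obtain ⟨r, j, q, hj, hx⟩ : ∃ r j q, j ≠ 0 ∧ x r j q ≠ 0 := by
    by_contra! hcon
    exact hD (logD_eq_zero_of_apply hcon)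
  obtain ⟨i, hi, hxi, hnext⟩ := exists_top hx
  obtain ⟨i, rfl⟩ := Fin.exists_succ_eq.2 (fun h0 => hj (Fin.le_zero_iff.1 (h0 ▸ hi)))
  have hn : next Λ N p x r i.castSucc q = x r i.succ q := by
    unfold next
    rw [dif_pos (by simp)]
    rfl
  rw [a_eq] at h
  have h1 := congrFun (congrFun (congrFun h r) i.succ) q
  have h0 := congrFun (congrFun (congrFun h r) i.castSucc) q
  simp only [smul_apply, theta_eq, add_apply, euler_apply, logD_apply, hn, hnext, mul_zero,
    add_zero] at h1 h0
  refine hxi (eq_zero_of_wronskian (z := x r i.castSucc q)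
    (c := (((i.castSucc : ℕ) + 1 : ℕ) : ℂ)) (Nat.cast_ne_zero.2 (Nat.succ_ne_zero _)) ?_)
  apply mul_left_cancel₀ (mul_ne_zero hT (PowerSeries.X_ne_zero (R := ℂ)))
  linear_combination x r i.succ q * h0 - x r i.castSucc q * h1

/-- A cyclic vector of a module of rank one can be normalized. -/
theorem exists_normalized {x : Xi Λ N p} (hx : x ≠ 0) {g : Cb} (h : ABAction.a x = g • x) :
    ∃ ν : ℂ, ∃ u : Cb, IsUnit u ∧ ∀ {E : Type*} [AddCommGroup E] [Module Cb E] [ABAction E]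
      (y : E), ABAction.a y = g • y → ABAction.a (u • y) = (PowerSeries.C ν * bb) • u • y := by
  obtain ⟨r, j, q, hj⟩ : ∃ r j q, x r j q ≠ 0 := by
    by_contra! hcon
    exact hx (Xi.ext hcon)
  obtain ⟨i, -, hi, hnext⟩ := exists_top hj
  obtain ⟨s, v, hv⟩ := IsDiscreteValuationRing.eq_unit_mul_pow_irreducible hi
    (PowerSeries.X_prime (R := ℂ)).irreducible
  rw [a_eq] at h
  have h1 := congrFun (congrFun (congrFun h r) i) q
  simp only [smul_apply, theta_eq, add_apply, euler_apply, logD_apply, hnext, mul_zero,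
    add_zero] at h1
  -- The top coefficient of `x` is `v b^s`, and its equation reads `g v = b((r + s)v + b v')`. So
  -- dividing by `v` leaves the exponent `r + s`. Only `g` enters, hence the same `u` serves in any
  -- module.
  refine ⟨(r : ℚ) + s, ↑v⁻¹, Units.isUnit _, fun y hy => ?_⟩
  have hvv : (v : Cb) * (↑v⁻¹ : Cb) = 1 := v.mul_inv
  have hd : (v : Cb) * bderiv (↑v⁻¹ : Cb) + (↑v⁻¹ : Cb) * bderiv (v : Cb) = 0 := by
    have := congrArg bderiv hvv
    simpa only [bderiv, Derivation.leibniz, smul_eq_mul, Derivation.map_one_eq_zero] using this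
  have hbs := bb_mul_bderiv_pow s
  have hg : bb * (PowerSeries.C ((r : ℚ) : ℂ) * v + PowerSeries.C (s : ℂ) * v + bb * bderiv (v : Cb))
      = g * v := by
    apply mul_right_cancel₀ (pow_ne_zero s (PowerSeries.X_ne_zero (R := ℂ)))
    rw [hv] at h1
    simp only [bderiv, Derivation.leibniz, smul_eq_mul] at h1 hbs ⊢
    linear_combination h1 - bb * v * hbs
  rw [ABAction.a_smul, hy, ← mul_smul, ← mul_smul, ← add_smul]
  congr 1
  apply mul_left_cancel₀ v.ne_zero
  rw [map_add]
  linear_combination (-(↑v⁻¹ : Cb)) * hg + bb ^ 2 * hd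

/-- The projection to the `ν`-eigenspace of `euler`. -/
noncomputable def proj (ν : ℂ) (f : Xi Λ N p) : Xi Λ N p := fun r j q =>
  PowerSeries.mk fun m => if ((r : ℚ) : ℂ) + m = ν then PowerSeries.coeff m (f r j q) else 0

theorem coeff_proj (ν : ℂ) (f : Xi Λ N p) (r j q) (m : ℕ) :
    PowerSeries.coeff m (proj ν f r j q) =
      if ((r : ℚ) : ℂ) + m = ν then PowerSeries.coeff m (f r j q) else 0 :=
  PowerSeries.coeff_mk _ _

theorem coeff_euler (f : Xi Λ N p) (r j q) (m : ℕ) :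
    PowerSeries.coeff m (euler Λ N p f r j q) =
      (((r : ℚ) : ℂ) + m) * PowerSeries.coeff m (f r j q) := by
  rw [euler_apply, map_add, PowerSeries.coeff_C_mul, add_mul]
  congr 1
  rcases m with _ | m
  · simp
  · rw [mul_comm bb, PowerSeries.coeff_succ_mul_X, bderiv, PowerSeries.coeff_derivative]
    push_cast; ring

theorem theta_proj (ν : ℂ) {f : Xi Λ N p} (hf : logD Λ N p f = 0) :
    theta Λ N p (proj ν f) = ν • proj ν f := by
  have hD : logD Λ N p (proj ν f) = 0 := logD_eq_zero_of_apply fun r j q hj => by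
    ext m
    rw [coeff_proj, apply_eq_zero_of_logD hf r hj q]
    simp
  rw [theta_eq, hD, add_zero]
  ext r j q m
  rw [coeff_euler, csmul_apply, coeff_proj, PowerSeries.coeff_smul, coeff_proj]
  split_ifs with h
  · rw [h, smul_eq_mul]
  · simp

/-- Without logarithms `θ` is diagonal, with eigenvalue `r + m` on `s^(r-1) b^m`. -/
theorem coeff_aeval_theta (P : ℂ[X]) {f : Xi Λ N p} (hf : logD Λ N p f = 0) (r j q) (m : ℕ) :
    PowerSeries.coeff m (aeval (theta Λ N p) P f r j q) =
      P.eval (((r : ℚ) : ℂ) + m) * PowerSeries.coeff m (f r j q) := by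
  have hpow : ∀ i : ℕ, logD Λ N p ((theta Λ N p ^ i) f) = 0 ∧
      PowerSeries.coeff m ((theta Λ N p ^ i) f r j q) =
        (((r : ℚ) : ℂ) + m) ^ i * PowerSeries.coeff m (f r j q) := by
    intro i
    induction i with
    | zero => simp [hf]
    | succ i ih =>
      rw [pow_succ', Module.End.mul_apply, logD_theta, ih.1, map_zero, theta_eq, ih.1, add_zero,
        coeff_euler, ih.2]
      exact ⟨rfl, by ring⟩
  induction P using Polynomial.induction_on' with
  | add P Q hP hQ =>
    rw [map_add, LinearMap.add_apply, add_apply, map_add, hP, hQ, eval_add, add_mul]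
  | monomial i c =>
    rw [aeval_monomial, Module.End.mul_apply, Module.algebraMap_end_apply, csmul_apply,
      PowerSeries.coeff_smul, (hpow i).2, eval_monomial, smul_eq_mul, mul_assoc]

/-- A polynomial in `theta` approximates the projection to an eigenspace. -/
theorem exists_aeval_sub_proj (ν : ℂ) (n : ℕ) : ∃ P : ℂ[X], P.eval ν = 1 ∧
    ∀ f : Xi Λ N p, logD Λ N p f = 0 → ∃ z, aeval (theta Λ N p) P f - proj ν f = bb ^ n • z := by
  classical
  -- The finitely many eigenvalues other than `ν` that occur below order `n`. The Lagrange
  -- polynomial that is 1 at `ν` and 0 on `s` agrees with the projection modulo `b^n`.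
  let s : Finset ℂ := (((Finset.univ : Finset Λ) ×ˢ Finset.range n).image
    fun t => ((t.1 : ℚ) : ℂ) + (t.2 : ℂ)).erase ν
  refine ⟨∏ μ ∈ s, C (ν - μ)⁻¹ * (X - C μ), ?_, fun f hf => ?_⟩
  · rw [eval_prod]
    refine Finset.prod_eq_one fun μ hμ => ?_
    have : ν - μ ≠ 0 := sub_ne_zero.2 (Finset.ne_of_mem_erase hμ).symm
    simp [this]
  · set P := ∏ μ ∈ s, C (ν - μ)⁻¹ * (X - C μ) with hPdef
    have hP1 : P.eval ν = 1 := by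
      rw [eval_prod]
      refine Finset.prod_eq_one fun μ hμ => ?_
      have : ν - μ ≠ 0 := sub_ne_zero.2 (Finset.ne_of_mem_erase hμ).symm
      simp [this]
    have hdvd : ∀ r j q, bb ^ n ∣ (aeval (theta Λ N p) P f - proj ν f) r j q := by
      intro r j q
      rw [PowerSeries.X_pow_dvd_iff]
      intro m hm
      rw [sub_apply, map_sub, coeff_aeval_theta P hf, coeff_proj]
      split_ifs with h
      · rw [h, hP1, one_mul, sub_self]
      · rw [sub_zero, hPdef, eval_prod, Finset.prod_eq_zero (i := ((r : ℚ) : ℂ) + m), zero_mul]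
        · exact Finset.mem_erase.2 ⟨h, Finset.mem_image.2 ⟨(r, m), by simpa using hm, rfl⟩⟩
        · simp
    choose z hz using hdvd
    exact ⟨z, Xi.ext hz⟩

end Xi

/-! ### Closedness and true eigenvectors -/

/-- Submodules of finite `ℂ[[b]]`-modules are `b`-adically closed. -/
theorem mem_of_forall_exists_sub {M : Type*} [AddCommGroup M] [Module Cb M] [Module.Finite Cb M]
    (W : Submodule Cb M) {x : M} (h : ∀ n : ℕ, ∃ w ∈ W, ∃ z, x - w = bb ^ n • z) : x ∈ W := by
  have hI : Ideal.span {bb} ≠ ⊤ := by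
    rw [Ne, Ideal.span_singleton_eq_top]
    exact PowerSeries.X_prime.not_isUnit
  -- Krull's intersection theorem in `M/W`.
  have hk := Ideal.iInf_pow_smul_eq_bot_of_isLocalRing (M := M ⧸ W) _ hI
  rw [← Submodule.Quotient.mk_eq_zero, ← Submodule.mem_bot Cb, ← hk, Submodule.mem_iInf]
  intro n
  obtain ⟨w, hw, z, hz⟩ := h n
  have : (Submodule.Quotient.mk x : M ⧸ W) = bb ^ n • Submodule.Quotient.mk z := by
    rw [← Submodule.Quotient.mk_smul, ← hz, Submodule.Quotient.mk_sub,
      (Submodule.Quotient.mk_eq_zero W).2 hw, sub_zero]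
  rw [this]
  exact Submodule.smul_mem_smul (Ideal.pow_mem_pow (Ideal.mem_span_singleton_self _) n) trivial

namespace Xi

variable {Λ : Finset ℚ} {N p : ℕ}

/-- With `B = (X - ν)Q`, the vector `Q(θ)e` is an eigenvector modulo `bW`. Its projection to the
`ν`-eigenspace changes it only by an element of `bW`: the approximations `P(θ)` have `P(ν) = 1`, so
`(P - 1)Q` is a multiple of `B`, and `bW` is closed. -/
theorem exists_eigenvector {e : Xi Λ N p} (he : logD Λ N p e = 0) {n : ℕ} {B : ℂ[X]}
    (hBm : B.Monic) (hBk : B.natDegree = n + 1)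
    (hB : aeval (theta Λ N p) B e ∈ bb • krylov (theta Λ N p) e (n + 1))
    (hli : LinearIndependent Cb fun i : Fin (n + 1) => (theta Λ N p ^ (i : ℕ)) e)
    {ν : ℂ} (hν : B.IsRoot ν) :
    ∃ y ∈ krylov (theta Λ N p) e (n + 1), y ∉ bb • krylov (theta Λ N p) e (n + 1) ∧
      theta Λ N p y = ν • y := by
  set W := krylov (theta Λ N p) e (n + 1) with hW
  obtain ⟨Q, hQ⟩ := dvd_iff_isRoot.2 hν
  have hQ0 : Q ≠ 0 := by rintro rfl; exact hBm.ne_zero (by simpa using hQ)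
  have hQd : Q.degree < ((n + 1 : ℕ) : WithBot ℕ) := by
    rw [← natDegree_lt_iff_degree_lt hQ0]
    have := congrArg natDegree hQ
    rw [natDegree_mul (X_sub_C_ne_zero ν) hQ0, natDegree_X_sub_C] at this
    omega
  set x := aeval (theta Λ N p) Q e with hx
  have hxW : x ∈ W := aeval_mem_krylov hQd
  have hx0 : x ∉ bb • W := fun h => hQ0 (eq_zero_of_aeval_mem hli hQd h)
  have hxD : logD Λ N p x = 0 := by
    refine aeval_mem_of_stable (W := LinearMap.ker (logD Λ N p)) (fun y hy => ?_) Q e he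
    rw [LinearMap.mem_ker] at hy ⊢
    rw [logD_theta, hy, map_zero]
  have hst := isEuler_theta.stable_bb_smul (isEuler_theta.krylov_stable hBm hBk hB)
  have hsub : proj ν x - x ∈ bb • W := by
    refine mem_of_forall_exists_sub _ fun m => ?_
    obtain ⟨P, hP, happ⟩ := exists_aeval_sub_proj (Λ := Λ) (N := N) (p := p) ν m
    obtain ⟨z, hz⟩ := happ x hxD
    refine ⟨aeval (theta Λ N p) P x - x, ?_, -z, ?_⟩
    · obtain ⟨R, hR⟩ : X - C ν ∣ P - 1 := dvd_iff_isRoot.2 (by simp [hP])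
      have : aeval (theta Λ N p) P x - x =
          aeval (theta Λ N p) R (aeval (theta Λ N p) B e) := by
        rw [hQ, hx, ← Module.End.mul_apply, ← Module.End.mul_apply, ← map_mul, ← map_mul,
          show R * ((X - C ν) * Q) = P * Q - Q by linear_combination (-Q) * hR]
        simp
      rw [this]
      exact aeval_mem_of_stable hst R _ hB
    · rw [smul_neg, ← hz]; abel
  have hbW : bb • W ≤ W := by
    intro y hy
    obtain ⟨z, hz, rfl⟩ := (Submodule.mem_smul_pointwise_iff_exists _ _ _).1 hy
    exact Submodule.smul_mem _ _ hz
  refine ⟨proj ν x, ?_, fun h => hx0 ?_, theta_proj ν hxD⟩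
  · have := add_mem (hbW hsub) hxW
    rwa [sub_add_cancel] at this
  · have := sub_mem h hsub
    rwa [sub_sub_cancel] at this

end Xi

/-- The relations form a submodule of rank 0 of a free module, hence zero. -/
theorem linearIndependent_of_le_finrank_span {M : Type*} [AddCommGroup M] [Module Cb M] {k : ℕ}
    {v : Fin k → M} (h : k ≤ Module.finrank Cb (Submodule.span Cb (Set.range v))) :
    LinearIndependent Cb v := by
  rw [Fintype.linearIndependent_iff]
  set f := Fintype.linearCombination Cb v with hf
  have hr : LinearMap.range f = Submodule.span Cb (Set.range v) :=
    Fintype.range_linearCombination Cb v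
  have h1 := Submodule.finrank_quotient_add_finrank (LinearMap.ker f)
  rw [f.quotKerEquivRange.finrank_eq, hr, Module.finrank_fin_fun] at h1
  have h2 : Module.finrank Cb (LinearMap.ker f) = 0 := by omega
  rw [Module.finrank_eq_zero_iff] at h2
  intro x hx
  obtain ⟨a, ha, hax⟩ := h2 ⟨x, hx⟩
  have : a • x = 0 := congrArg Subtype.val hax
  exact congrFun ((smul_eq_zero.1 this).resolve_left ha)

/-- `x` generates `F` under the action of `ℂ[[b]]` and `a`. -/
def Generates {E : Type*} [AddCommGroup E] [Module Cb E] [ABAction E] (x : E)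
    (F : Submodule Cb E) : Prop :=
  x ∈ F ∧ ∀ p : Submodule Cb E, x ∈ p → (∀ y ∈ p, ABAction.a y ∈ p) → F ≤ p

/-! ### Jordan–Hölder numbers and exponents of eigenvectors -/

section JordanHolder

variable {E : Type*} [AddCommGroup E] [Module Cb E] [ABAction E]
  {k : ℕ} {F : ℕ → ABSubmodule E} {lam : ℕ → ℂ}

theorem IsJordanHolder.exists_functional (hF : IsJordanHolder k F lam) {j : ℕ}
    (hj : j ∈ Finset.Icc 1 k) : ∃ ψ : F j →ₗ[Cb] Cb, Function.Surjective ψ ∧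
      (∀ x, ψ x = 0 ↔ (x : E) ∈ (F (j - 1)).toSubmodule) ∧
      ∀ x, ψ (ABAction.a x) = Elam.act (lam j) (ψ x) := by
  obtain ⟨φ, hφ⟩ := hF.quot j hj
  let ι : Elam (lam j) ≃ₗ[Cb] Cb := LinearEquiv.refl Cb Cb
  let K := ((F (j - 1)).restrict (F j)).toSubmodule
  refine ⟨(φ.trans ι).toLinearMap ∘ₗ K.mkQ, ?_, fun x => ?_, fun x => ?_⟩
  · rw [LinearMap.coe_comp]
    exact (φ.trans ι).surjective.comp K.mkQ_surjective
  · have : K.mkQ x = 0 ↔ x ∈ K := by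
      rw [Submodule.mkQ_apply, Submodule.Quotient.mk_eq_zero]
    rw [LinearMap.comp_apply, LinearEquiv.coe_coe, LinearEquiv.map_eq_zero_iff, this]
    rfl
  · exact hφ (Submodule.Quotient.mk x)

/-- The image of a generator in the rank 1 quotient is a unit, and `T` normalizes it to 1. Then `(a
- λ_j b)Tx` falls into `F_{j-1}`, and modulo what it generates `F_j` is spanned by `Tx`, whose
multiples meet `F_{j-1}` only in zero. -/
theorem IsJordanHolder.exists_generator_pred (hF : IsJordanHolder k F lam) {j : ℕ}
    (hj : j ∈ Finset.Icc 1 k) {x : E} (hx : Generates x (F j).toSubmodule) :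
    ∃ T : Cb, PowerSeries.constantCoeff T ≠ 0 ∧
      Generates (ABAction.a (T • x) - (PowerSeries.C (lam j) * bb) • T • x)
        (F (j - 1)).toSubmodule := by
  obtain ⟨ψ, hsurj, hker, hact⟩ := hF.exists_functional hj
  have hmono := hF.mono j hj
  set x' : F j := ⟨x, hx.1⟩
  -- Otherwise `x` would lie in the preimage of `b ℂ[[b]]`, which is proper and stable.
  have hu : PowerSeries.constantCoeff (ψ x') ≠ 0 := by
    intro h0
    obtain ⟨y, hy⟩ := hsurj 1
    let I : Submodule Cb (F j) := Submodule.comap ψ (Ideal.span {bb} : Ideal Cb)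
    have hmem : ∀ z, z ∈ I ↔ PowerSeries.constantCoeff (ψ z) = 0 := fun z => by
      rw [Submodule.mem_comap, Ideal.mem_span_singleton, PowerSeries.X_dvd_iff]
    have hle := hx.2 (I.map (F j).toSubmodule.subtype)
      ⟨x', (hmem _).2 h0, rfl⟩ (by
        rintro _ ⟨z, _, rfl⟩
        refine ⟨ABAction.a z, (hmem _).2 ?_, rfl⟩
        rw [hact]
        simp [Elam.act])
    obtain ⟨z, hz, hzy⟩ := hle y.2
    have : z = y := Subtype.ext hzy
    subst this
    have := (hmem _).1 hz
    rw [hy] at this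
    simp at this
  obtain ⟨u, hu'⟩ : IsUnit (ψ x') := PowerSeries.isUnit_iff_constantCoeff.2 hu.isUnit
  set T : Cb := ↑u⁻¹
  have hTu : T * ψ x' = 1 := by rw [← hu']; exact u.inv_mul
  have hTx : ψ (T • x') = 1 := by rw [map_smul, smul_eq_mul, hTu]
  set x1 := ABAction.a (T • x) - (PowerSeries.C (lam j) * bb) • T • x with hx1
  have hx1F : x1 ∈ (F (j - 1)).toSubmodule := by
    have : ψ (ABAction.a (T • x') - (PowerSeries.C (lam j) * bb) • T • x') = 0 := by
      rw [map_sub, hact, map_smul ψ (_ * _), hTx]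
      simp [Elam.act]
    exact (hker _).1 this
  refine ⟨T, ?_, hx1F, fun p hp hst y hy => ?_⟩
  · intro h0
    have := congrArg PowerSeries.constantCoeff hTu
    simp [h0] at this
  · have hle := hx.2 ((p ⊓ (F (j - 1)).toSubmodule) ⊔ Submodule.span Cb {T • x})
      (Submodule.mem_sup_right (by
        have hinv : ψ x' • T • x = x := by rw [← mul_smul, mul_comm, hTu, one_smul]
        have := Submodule.smul_mem _ (ψ x') (Submodule.mem_span_singleton_self (R := Cb) (T • x))
        rwa [hinv] at this))
      (by
        intro z hz
        obtain ⟨z1, hz1, z2, hz2, rfl⟩ := Submodule.mem_sup.1 hz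
        obtain ⟨S, rfl⟩ := Submodule.mem_span_singleton.1 hz2
        have e1 : ABAction.a (z1 + S • T • x) = (ABAction.a z1 + S • x1) +
            (S * (PowerSeries.C (lam j) * bb) + bb ^ 2 * bderiv S) • T • x := by
          rw [map_add, ABAction.a_smul S, hx1, smul_sub, add_smul, mul_smul S]
          abel
        rw [e1]
        refine Submodule.add_mem_sup ⟨p.add_mem (hst _ hz1.1) (p.smul_mem _ hp),
          Submodule.add_mem _ ((F (j - 1)).a_mem _ hz1.2) (Submodule.smul_mem _ _ hx1F)⟩
          (Submodule.smul_mem _ _ (Submodule.mem_span_singleton_self _)))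
    obtain ⟨z1, hz1, z2, hz2, hyz⟩ := Submodule.mem_sup.1 (hle (hmono hy))
    obtain ⟨S, rfl⟩ := Submodule.mem_span_singleton.1 hz2
    have h2 : S • T • x ∈ (F (j - 1)).toSubmodule := by
      have := sub_mem hy hz1.2
      rwa [← hyz, add_sub_cancel_left] at this
    have h3 : ψ (S • T • x') = 0 := (hker _).2 h2
    rw [map_smul, hTx, smul_eq_mul, mul_one] at h3
    rw [← hyz, h3, zero_smul, add_zero]
    exact hz1.1

theorem IsJordanHolder.finrank_eq [Module.Finite Cb E] (hF : IsJordanHolder k F lam) :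
    Module.finrank Cb E = k := by
  have h : ∀ j ≤ k, Module.finrank Cb (F j).toSubmodule = j := by
    intro j
    induction j with
    | zero => intro _; rw [hF.bot]; exact finrank_bot Cb E
    | succ j ih =>
      intro hj
      have hj' : j + 1 ∈ Finset.Icc 1 k := Finset.mem_Icc.2 ⟨by omega, hj⟩
      obtain ⟨φ, -⟩ := hF.quot _ hj'
      have h1 := Submodule.finrank_quotient_add_finrank ((F j).restrict (F (j + 1))).toSubmodule
      have h2 : Module.finrank Cb (F (j + 1) ⧸ ((F j).restrict (F (j + 1))).toSubmodule) = 1 := by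
        refine φ.finrank_eq.trans ?_
        exact Module.finrank_self Cb
      have h3 : Module.finrank Cb ((F j).restrict (F (j + 1))).toSubmodule =
          Module.finrank Cb (F j).toSubmodule :=
        (Submodule.comapSubtypeEquivOfLe (hF.mono _ hj')).finrank_eq
      rw [h2, h3, ih (by omega)] at h1
      omega
  rw [← h k le_rfl, hF.top, finrank_top]

/-- The Bernstein polynomial given by a Jordan-Hölder sequence. -/
noncomputable def bernsteinPoly (k : ℕ) (lam : ℕ → ℂ) (j : ℕ) : ℂ[X] :=
  ∏ i ∈ Finset.range j, (X - C (lam (k - i) - i))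

theorem bernsteinPoly_monic (j : ℕ) : (bernsteinPoly k lam j).Monic :=
  monic_prod_of_monic _ _ fun _ _ => monic_X_sub_C _

theorem natDegree_bernsteinPoly (j : ℕ) : (bernsteinPoly k lam j).natDegree = j := by
  rw [bernsteinPoly, natDegree_prod_of_monic _ _ fun _ _ => monic_X_sub_C _]
  simp only [natDegree_X_sub_C, Finset.sum_const, Finset.card_range, smul_eq_mul, mul_one]

/-- With `k = n + 1` and `j = k - i`, the root `λ_{k-i} - i` plus `n` is `λ_j + j - 1`. -/
theorem isRoot_bernsteinPoly {n : ℕ} {ν : ℂ} :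
    (bernsteinPoly (n + 1) lam (n + 1)).IsRoot (ν - n) ↔
      ∃ j ∈ Finset.Icc 1 (n + 1), ν = lam j + j - 1 := by
  rw [bernsteinPoly, IsRoot.def, eval_prod, Finset.prod_eq_zero_iff]
  constructor
  · rintro ⟨i, hi, h⟩
    rw [Finset.mem_range] at hi
    refine ⟨n + 1 - i, Finset.mem_Icc.2 ⟨by omega, by omega⟩, ?_⟩
    rw [eval_sub, eval_X, eval_C] at h
    rw [Nat.cast_sub hi.le]
    push_cast
    linear_combination h
  · rintro ⟨j, hj, rfl⟩
    obtain ⟨h1, h2⟩ := Finset.mem_Icc.1 hj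
    refine ⟨n + 1 - j, Finset.mem_range.2 (by omega), ?_⟩
    rw [eval_sub, eval_X, eval_C, Nat.sub_sub_self h2, Nat.cast_sub h2]
    push_cast
    ring

variable {Λ : Finset ℚ} {N p : ℕ} {ι : E →ₗ[Cb] Xi Λ N p}

/-- `F_{k-j}` has a generator of the form `b^j (c B_j(θ)e + b w)` with `c ≠ 0`. For `j = k` this
generator is zero, which is a monic relation for `e` modulo `b`. -/
theorem IsJordanHolder.aeval_bernsteinPoly_mem (hF : IsJordanHolder k F lam)
    (ha : ∀ x, ι (ABAction.a x) = ABAction.a (ι x)) {e : E} (he : Generates e ⊤) :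
    aeval (Xi.theta Λ N p) (bernsteinPoly k lam k) (ι e) ∈
      bb • krylov (Xi.theta Λ N p) (ι e) k := by
  have h : ∀ j ≤ k, ∃ x : E, Generates x (F (k - j)).toSubmodule ∧ ∃ c : ℂ, c ≠ 0 ∧
      ∃ w ∈ krylov (Xi.theta Λ N p) (ι e) (j + 1),
        ι x = bb ^ j • (c • aeval (Xi.theta Λ N p) (bernsteinPoly k lam j) (ι e) + bb • w) := by
    intro j
    induction j with
    | zero =>
      intro _
      refine ⟨e, by rw [Nat.sub_zero, hF.top]; exact he, 1, one_ne_zero, 0, zero_mem _, ?_⟩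
      simp [bernsteinPoly]
    | succ j ih =>
      intro hj
      obtain ⟨x, hx, c, hc, w, hw, hxw⟩ := ih (by omega)
      obtain ⟨T, hT, hgen⟩ :=
        hF.exists_generator_pred (Finset.mem_Icc.2 ⟨by omega, Nat.sub_le _ _⟩) hx
      obtain ⟨c', hc', w', hw', hstep⟩ := exists_step Xi.isEuler_theta
        (natDegree_bernsteinPoly (k := k) (lam := lam) j) hc hw hT (lam (k - j))
      refine ⟨_, hgen, c', hc', w', hw', ?_⟩
      rw [bernsteinPoly, Finset.prod_range_succ, mul_comm (∏ i ∈ _, _), ← bernsteinPoly, ← hstep, map_sub, ha,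
        map_smul ι, map_smul ι (_ * _), map_smul ι, Xi.a_eq, hxw, smul_sub, mul_comm _ bb, mul_smul bb,
        C_smul_eq]
  obtain ⟨x, hx, c, hc, w, hw, hxw⟩ := h k le_rfl
  have hx0 : x = 0 := by
    have := hx.1
    rwa [Nat.sub_self, hF.bot, Submodule.mem_bot] at this
  rw [hx0, map_zero] at hxw
  exact aeval_mem_of_add_eq_zero (bernsteinPoly_monic k) (natDegree_bernsteinPoly k) hc hw
    (bb_pow_smul_injective k (by simpa using hxw.symm))

theorem finite_of_injective (hι : Function.Injective ι) : Module.Finite Cb E :=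
  Module.Finite.of_injective ι hι

theorem pow_theta_mem_range (ha : ∀ x, ι (ABAction.a x) = ABAction.a (ι x)) (e : E) (i : ℕ) :
    bb ^ i • (Xi.theta Λ N p ^ i) (ι e) ∈ LinearMap.range ι := by
  induction i with
  | zero => simp
  | succ i ih =>
    obtain ⟨y, hy⟩ := ih
    -- `b^(i+1) θ^(i+1) = (a - i b) b^i θ^i`, since `θ b^i = b^i (θ + i)`.
    refine ⟨ABAction.a y - (PowerSeries.C (i : ℂ) * bb) • y, ?_⟩
    rw [map_sub, ha, map_smul, hy, Xi.a_eq, Xi.isEuler_theta.pow_smul, smul_add, smul_add,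
      ← mul_smul, ← pow_succ', pow_succ' (Xi.theta Λ N p), Module.End.mul_apply, mul_smul,
      C_smul_eq, smul_comm (i : ℂ) bb, smul_comm (i : ℂ) (bb ^ i)]
    abel

/-- The lattice is `a`-stable because `a b^i θ^i e = b^(i+1) θ^(i+1) e + i b^(i+1) θ^i e`. The only
overflow, `b^(n+1) θ^(n+1) e`, returns to it since `b^n W` is contained in it. -/
theorem range_eq_krylovLattice (ha : ∀ x, ι (ABAction.a x) = ABAction.a (ι x)) {e : E}
    (he : Generates e ⊤) {n : ℕ}
    (hst : ∀ x ∈ krylov (Xi.theta Λ N p) (ι e) (n + 1),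
      Xi.theta Λ N p x ∈ krylov (Xi.theta Λ N p) (ι e) (n + 1)) :
    LinearMap.range ι = krylovLattice (Xi.theta Λ N p) (ι e) (n + 1) := by
  apply le_antisymm
  · have hle := he.2 ((krylovLattice (Xi.theta Λ N p) (ι e) (n + 1)).comap ι)
      (Submodule.subset_span ⟨0, by simp⟩) (by
        intro y hy
        rw [Submodule.mem_comap] at hy ⊢
        rw [ha]
        generalize ι y = z at hy
        induction hy using Submodule.span_induction with
        | mem z h =>
          obtain ⟨i, rfl⟩ := h
          change ABAction.a (bb ^ (i : ℕ) • (Xi.theta Λ N p ^ (i : ℕ)) (ι e)) ∈ _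
          rw [Xi.a_eq, Xi.isEuler_theta.pow_smul, smul_add, smul_add, ← mul_smul, ← pow_succ',
            ← Module.End.mul_apply, ← pow_succ', smul_comm _ (i : ℂ), smul_comm _ (i : ℂ)]
          refine add_mem ?_ (csmul_mem _ _ (Submodule.smul_mem _ _ (Submodule.subset_span ⟨i, rfl⟩)))
          rcases (Nat.succ_le_of_lt i.2).lt_or_eq with h | h
          · exact Submodule.subset_span ⟨⟨i + 1, h⟩, rfl⟩
          · have hi : (i : ℕ) = n := by omega
            rw [hi, pow_succ', mul_smul, pow_succ', Module.End.mul_apply]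
            exact Submodule.smul_mem _ _
              (pow_smul_mem_krylovLattice (hst _ (pow_mem_krylov (Nat.lt_succ_self n))))
        | zero => rw [map_zero]; exact zero_mem _
        | add x y _ _ hx hy => rw [map_add]; exact add_mem hx hy
        | smul S x h hx =>
          rw [ABAction.a_smul]
          exact add_mem (Submodule.smul_mem _ _ hx) (Submodule.smul_mem _ _ h))
    rintro _ ⟨y, rfl⟩
    exact hle trivial
  · rw [krylovLattice, Submodule.span_le]
    rintro _ ⟨i, rfl⟩
    exact pow_theta_mem_range ha e i

variable {n : ℕ}

/-- The `n + 1` vectors span a module containing the image of `E`, which has rank `n + 1`. -/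
theorem IsJordanHolder.linearIndependent (hF : IsJordanHolder (n + 1) F lam)
    (hι : Function.Injective ι) (ha : ∀ x, ι (ABAction.a x) = ABAction.a (ι x)) {e : E}
    (he : Generates e ⊤) :
    LinearIndependent Cb fun i : Fin (n + 1) => (Xi.theta Λ N p ^ (i : ℕ)) (ι e) := by
  have := finite_of_injective hι
  apply linearIndependent_of_le_finrank_span
  have hst := Xi.isEuler_theta.krylov_stable (bernsteinPoly_monic _) (natDegree_bernsteinPoly _)
    (hF.aeval_bernsteinPoly_mem ha he)
  have h1 : LinearMap.range ι ≤ krylov (Xi.theta Λ N p) (ι e) (n + 1) :=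
    (range_eq_krylovLattice ha he hst).trans_le (krylovLattice_le _)
  calc n + 1 = Module.finrank Cb E := hF.finrank_eq.symm
    _ = Module.finrank Cb (LinearMap.range ι) := (LinearMap.finrank_range_of_inj hι).symm
    _ ≤ _ := Submodule.finrank_mono h1

theorem mem_bb_smul_range {x : E} (hι : Function.Injective ι) :
    ι x ∈ bb • LinearMap.range ι ↔ ∃ z, x = bb • z := by
  rw [Submodule.mem_smul_pointwise_iff_exists]
  constructor
  · rintro ⟨_, ⟨z, rfl⟩, h⟩
    exact ⟨z, hι (by rw [map_smul, h])⟩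
  · rintro ⟨z, rfl⟩
    exact ⟨_, ⟨z, rfl⟩, by rw [map_smul]⟩

theorem theta_eq_of_a_eq (ha : ∀ x, ι (ABAction.a x) = ABAction.a (ι x)) {x : E} {ν : ℂ}
    (hx : ABAction.a x = (PowerSeries.C ν * bb) • x) : Xi.theta Λ N p (ι x) = ν • ι x := by
  have h := ha x
  rw [hx, map_smul, Xi.a_eq, mul_comm, mul_smul, C_smul_eq] at h
  exact (smul_right_injective _ PowerSeries.X_ne_zero h).symm

theorem a_eq_of_theta_eq (hι : Function.Injective ι)
    (ha : ∀ x, ι (ABAction.a x) = ABAction.a (ι x)) {x : E} {ν : ℂ}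
    (hx : Xi.theta Λ N p (ι x) = ν • ι x) : ABAction.a x = (PowerSeries.C ν * bb) • x := by
  apply hι
  rw [ha, Xi.a_eq, hx, map_smul, mul_comm, mul_smul, C_smul_eq]

/-- The exponents of primitive eigenvectors are read on any Jordan-Hölder sequence. -/
theorem IsJordanHolder.exists_eq_of_eigenvector (hF : IsJordanHolder k F lam)
    (hι : Function.Injective ι) (ha : ∀ x, ι (ABAction.a x) = ABAction.a (ι x)) {e : E}
    (he : Generates e ⊤) {x : E} {ν : ℂ} (hx : ABAction.a x = (PowerSeries.C ν * bb) • x)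
    (hx0 : ¬ ∃ z, x = bb • z) : ∃ j ∈ Finset.Icc 1 k, ν = lam j + j - 1 := by
  rcases k with _ | n
  · have : x ∈ (⊤ : Submodule Cb E) := trivial
    rw [← hF.top, hF.bot, Submodule.mem_bot] at this
    exact absurd ⟨0, by rw [this, smul_zero]⟩ hx0
  · have hB := hF.aeval_bernsteinPoly_mem ha he
    have hm := bernsteinPoly_monic (k := n + 1) (lam := lam) (n + 1)
    have hd := natDegree_bernsteinPoly (k := n + 1) (lam := lam) (n + 1)
    have hr := range_eq_krylovLattice ha he (Xi.isEuler_theta.krylov_stable hm hd hB)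
    rw [← isRoot_bernsteinPoly]
    refine isRoot_of_eigenvector Xi.isEuler_theta hm hd hB (hF.linearIndependent hι ha he)
      (x := ι x) (hr ▸ ⟨x, rfl⟩) ?_ (theta_eq_of_a_eq ha hx)
    rw [← hr, mem_bb_smul_range hι]
    exact hx0

/-- Without logarithms every exponent is that of a primitive eigenvector. -/
theorem IsJordanHolder.exists_eigenvector (hF : IsJordanHolder k F lam)
    (hι : Function.Injective ι) (ha : ∀ x, ι (ABAction.a x) = ABAction.a (ι x)) {e : E}
    (he : Generates e ⊤) (hD : Xi.logD Λ N p (ι e) = 0) {j : ℕ} (hj : j ∈ Finset.Icc 1 k) :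
    ∃ x : E, ABAction.a x = (PowerSeries.C (lam j + j - 1) * bb) • x ∧ ¬ ∃ z, x = bb • z := by
  rcases k with _ | n
  · simp at hj
  · have hB := hF.aeval_bernsteinPoly_mem ha he
    have hm := bernsteinPoly_monic (k := n + 1) (lam := lam) (n + 1)
    have hd := natDegree_bernsteinPoly (k := n + 1) (lam := lam) (n + 1)
    have hr := range_eq_krylovLattice ha he (Xi.isEuler_theta.krylov_stable hm hd hB)
    have hli := hF.linearIndependent hι ha he
    obtain ⟨y, hy, hy0, hyν⟩ := Xi.exists_eigenvector hD hm hd hB hli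
      (isRoot_bernsteinPoly.2 ⟨j, hj, rfl⟩)
    obtain ⟨x, hx⟩ : bb ^ n • y ∈ LinearMap.range ι := hr ▸ pow_smul_mem_krylovLattice hy
    refine ⟨x, a_eq_of_theta_eq hι ha ?_, ?_⟩
    · rw [hx, Xi.isEuler_theta.pow_smul, hyν, ← add_smul, sub_add_cancel, smul_comm]
    · rw [← mem_bb_smul_range hι, hx, hr]
      exact pow_smul_notMem_bb_krylovLattice Xi.isEuler_theta hm hd hB hli hy hy0 hyν

end JordanHolder

/-! ### Kernels of morphisms from cyclic modules -/

section CyclicKernel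

variable {E : Type*} [AddCommGroup E] [Module Cb E] [ABAction E] {Λ : Finset ℚ} {N p : ℕ}

/-- In a relation not divisible by `b`, the last unit coefficient would express its vector by
earlier ones modulo `bH`. So every coefficient is divisible by `b`; cancel `b` and repeat. -/
theorem linearIndependent_of_notMem {M : Type*} [AddCommGroup M] [Module Cb M]
    [Module.IsTorsionFree Cb M] {l : ℕ} {v : ℕ → M} {H : Submodule Cb M} (hv : ∀ i, v i ∈ H)
    (h : ∀ i < l, v i ∉ Submodule.span Cb (Set.range fun j : Fin i => v j) ⊔ bb • H) :
    LinearIndependent Cb fun i : Fin l => v i := by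
  classical
  rw [Fintype.linearIndependent_iff]
  have key : ∀ c : Fin l → Cb, ∑ i, c i • v i = 0 → ∀ i, bb ∣ c i := by
    intro c hc
    by_contra! hcon
    obtain ⟨i, hi⟩ := hcon
    obtain ⟨m, hm, hmax⟩ := Finset.exists_max_image (Finset.univ.filter fun i => ¬ bb ∣ c i) id
      ⟨i, by simpa using hi⟩
    have hm' : ¬ bb ∣ c m := by simpa using hm
    obtain ⟨u, hu⟩ : IsUnit (c m) := by
      rw [PowerSeries.isUnit_iff_constantCoeff]
      rw [PowerSeries.X_dvd_iff] at hm'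
      exact Ne.isUnit hm'
    refine h m m.2 ?_
    have h1 : v m = (↑u⁻¹ : Cb) • -∑ i ∈ Finset.univ.erase m, c i • v i := by
      rw [← Finset.add_sum_erase _ _ (Finset.mem_univ m)] at hc
      rw [← eq_neg_of_add_eq_zero_left hc, ← hu, ← mul_smul, Units.inv_mul, one_smul]
    rw [h1]
    refine Submodule.smul_mem _ _ (neg_mem (Submodule.sum_mem _ fun i hi => ?_))
    rcases lt_or_ge i m with hlt | hge
    · exact Submodule.mem_sup_left (Submodule.smul_mem _ _ (Submodule.subset_span ⟨⟨i, hlt⟩, rfl⟩))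
    · have hd : bb ∣ c i := by
        by_contra hnd
        exact Finset.ne_of_mem_erase hi (le_antisymm (hmax i (by simpa using hnd)) hge)
      obtain ⟨g, hg⟩ := hd
      rw [hg, mul_smul]
      exact Submodule.mem_sup_right
        (Submodule.smul_mem_pointwise_smul _ _ _ (Submodule.smul_mem _ _ (hv i)))
  have hpow : ∀ n : ℕ, ∀ c : Fin l → Cb, ∑ i, c i • v i = 0 → ∀ i, bb ^ n ∣ c i := by
    intro n
    induction n with
    | zero => simp
    | succ n ih =>
      intro c hc i
      choose g hg using key c hc
      have hg0 : ∑ i, g i • v i = 0 := by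
        apply smul_right_injective M (PowerSeries.X_ne_zero (R := ℂ))
        simp only [Finset.smul_sum, smul_zero, ← mul_smul]
        rw [← hc]
        exact Finset.sum_congr rfl fun i _ => by rw [hg i]
      rw [hg i, pow_succ']
      exact mul_dvd_mul_left _ (ih g hg0 i)
  intro c hc i
  ext m
  exact PowerSeries.X_pow_dvd_iff.1 (hpow (m + 1) c hc i) m m.lt_succ_self

/-- The kernel of a morphism from a cyclic module to a torsion-free module is cyclic. -/
theorem exists_generates_ker {M : Type*} [AddCommGroup M] [Module Cb M] [ABAction M]
    [Module.IsTorsionFree Cb M] [Module.Finite Cb M] (κ : E →ₗ[Cb] M)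
    (hκ : ∀ x, κ (ABAction.a x) = ABAction.a (κ x)) {e : E} (he : Generates e ⊤) :
    ∃ f : E, Generates f (LinearMap.ker κ) := by
  classical
  set w : ℕ → E := fun i => (ABAction.a (E := E))^[i] e with hw
  have hws : ∀ i, ABAction.a (w i) = w (i + 1) := fun i => by
    rw [hw]; simp only [Function.iterate_succ', Function.comp]
  set v : ℕ → M := fun i => κ (w i) with hvdef
  have hvs : ∀ i, ABAction.a (v i) = v (i + 1) := fun i => by
    simp only [hvdef, ← hκ, hws]
  set H := LinearMap.range κ
  have hvH : ∀ i, v i ∈ H := fun i => ⟨_, rfl⟩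
  let K : ℕ → Submodule Cb M := fun n => Submodule.span Cb (Set.range fun j : Fin n => v j)
  have hvK : ∀ {i n}, i < n → v i ∈ K n := fun {i n} h => Submodule.subset_span ⟨⟨i, h⟩, rfl⟩
  have hKmono : Monotone K := fun m n hmn => Submodule.span_le.2 (by
    rintro _ ⟨i, rfl⟩
    exact hvK (i.2.trans_le hmn))
  have hex : ∃ l, v l ∈ K l ⊔ bb • H := by
    obtain ⟨n, hn⟩ := monotone_stabilizes_iff_noetherian.2
      (inferInstanceAs (IsNoetherian Cb M)) ⟨K, hKmono⟩
    refine ⟨n, Submodule.mem_sup_left ?_⟩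
    have : K n = K (n + 1) := hn (n + 1) n.le_succ
    rw [this]
    exact hvK n.lt_succ_self
  -- The least `l` for which `v l` depends on its predecessors modulo `bH`. Minimality makes these
  -- predecessors independent; Nakayama's lemma makes them span the image `H`.
  set l := Nat.find hex with hl
  have hlmem : v l ∈ K l ⊔ bb • H := Nat.find_spec hex
  have hli : LinearIndependent Cb fun i : Fin l => v i :=
    linearIndependent_of_notMem hvH fun i hi => Nat.find_min hex hi
  have hstep : ∀ y ∈ K l ⊔ bb • H, ABAction.a y ∈ K l ⊔ bb • H := by
    intro y hy
    obtain ⟨y1, hy1, y2, hy2, rfl⟩ := Submodule.mem_sup.1 hy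
    rw [map_add]
    refine add_mem ?_ (Submodule.mem_sup_right ?_)
    · clear hy
      induction hy1 using Submodule.span_induction with
      | mem z h =>
        obtain ⟨i, rfl⟩ := h
        change ABAction.a (v i) ∈ _
        rw [hvs]
        rcases (Nat.succ_le_of_lt i.2).lt_or_eq with h | h
        · exact Submodule.mem_sup_left (hvK h)
        · rw [show (i : ℕ) + 1 = l from h]; exact hlmem
      | zero => rw [map_zero]; exact zero_mem _
      | add x y _ _ hx hy => rw [map_add]; exact add_mem hx hy
      | smul S x h hx =>
        rw [ABAction.a_smul]
        exact add_mem (Submodule.smul_mem _ _ hx)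
          (Submodule.smul_mem _ _ (Submodule.mem_sup_left h))
    · obtain ⟨_, ⟨z, rfl⟩, rfl⟩ := (Submodule.mem_smul_pointwise_iff_exists _ _ _).1 hy2
      rw [ABAction.a_smul, ← hκ, sq, mul_assoc, mul_smul, ← smul_add]
      exact Submodule.smul_mem_pointwise_smul _ _ _ (add_mem ⟨_, rfl⟩ (Submodule.smul_mem _ _ ⟨z, rfl⟩))
  have hv0 : v 0 ∈ K l ⊔ bb • H := by
    rcases Nat.eq_zero_or_pos l with h | h
    · have := hlmem; rwa [h] at this ⊢
    · exact Submodule.mem_sup_left (hvK h)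
  have hHK : H ≤ K l := by
    have hle := he.2 ((K l ⊔ bb • H).comap κ) hv0 (fun y hy => by
      rw [Submodule.mem_comap, hκ]
      exact hstep _ hy)
    refine Submodule.le_of_le_smul_of_le_jacobson_bot (I := Ideal.span {bb})
      (IsNoetherian.noetherian H) ?_ ?_
    · rw [IsLocalRing.jacobson_eq_maximalIdeal _ bot_ne_top, Ideal.span_singleton_le_iff_mem,
        IsLocalRing.mem_maximalIdeal]
      exact PowerSeries.X_prime.not_isUnit
    · rw [Submodule.ideal_span_singleton_smul]
      rintro _ ⟨y, rfl⟩
      exact hle trivial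
  obtain ⟨c, hc⟩ := (Submodule.mem_span_range_iff_exists_fun Cb).1 (hHK (hvH l))
  -- The monic relation for the image of `e`, lifted to `E`. Dividing by it leaves a remainder in
  -- the span of `w 0, …, w (l-1)`, which vanishes on the kernel by independence.
  set f := w l - ∑ i : Fin l, c i • w i with hf
  have hfk : f ∈ LinearMap.ker κ := by
    rw [LinearMap.mem_ker, hf, map_sub, map_sum, sub_eq_zero]
    simp only [map_smul]
    exact hc.symm
  refine ⟨f, hfk, fun q hq hst y hy => ?_⟩
  set R := Submodule.span Cb (Set.range fun i : Fin l => w i) with hR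
  have hkst : ∀ z ∈ LinearMap.ker κ, ABAction.a z ∈ LinearMap.ker κ := fun z hz => by
    rw [LinearMap.mem_ker] at hz ⊢
    rw [hκ, hz, map_zero]
  have hwR : ∀ i, i < l → w i ∈ R := fun i h => Submodule.subset_span ⟨⟨i, h⟩, rfl⟩
  have hwl : w l ∈ (q ⊓ LinearMap.ker κ) ⊔ R := by
    have : w l = f + ∑ i : Fin l, c i • w i := by rw [hf]; abel
    rw [this]
    exact Submodule.add_mem_sup ⟨hq, hfk⟩
      (Submodule.sum_mem _ fun i _ => Submodule.smul_mem _ _ (hwR i i.2))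
  have hle := he.2 ((q ⊓ LinearMap.ker κ) ⊔ R) (by
      rcases Nat.eq_zero_or_pos l with h | h
      · rw [h] at hwl; exact hwl
      · exact Submodule.mem_sup_right (hwR 0 h)) (by
      intro z hz
      obtain ⟨z1, hz1, z2, hz2, rfl⟩ := Submodule.mem_sup.1 hz
      rw [map_add]
      refine add_mem (Submodule.mem_sup_left ⟨hst _ hz1.1, hkst _ hz1.2⟩) ?_
      clear hz
      induction hz2 using Submodule.span_induction with
      | mem z h =>
        obtain ⟨i, rfl⟩ := h
        change ABAction.a (w i) ∈ _
        rw [hws]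
        rcases (Nat.succ_le_of_lt i.2).lt_or_eq with h | h
        · exact Submodule.mem_sup_right (hwR _ h)
        · rw [show (i : ℕ) + 1 = l from h]; exact hwl
      | zero => rw [map_zero]; exact zero_mem _
      | add x y _ _ hx hy => rw [map_add]; exact add_mem hx hy
      | smul S x h hx =>
        rw [ABAction.a_smul]
        exact add_mem (Submodule.smul_mem _ _ hx)
          (Submodule.smul_mem _ _ (Submodule.mem_sup_right h)))
  obtain ⟨z1, hz1, z2, hz2, rfl⟩ := Submodule.mem_sup.1 (hle trivial : y ∈ _)
  obtain ⟨d, rfl⟩ := (Submodule.mem_span_range_iff_exists_fun Cb).1 hz2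
  have hd : ∑ i, d i • v i = 0 := by
    have h1 := LinearMap.mem_ker.1 hy
    rw [map_add, LinearMap.mem_ker.1 hz1.2, zero_add, map_sum] at h1
    simpa only [map_smul] using h1
  have hd0 := Fintype.linearIndependent_iff.1 hli d hd
  simpa [hd0] using hz1.1

end CyclicKernel

/-! ### The semi-simple part as the kernel of `∂/∂Log s` -/

section SemisimplePart

variable {E : Type*} [AddCommGroup E] [Module Cb E] [ABAction E] {Λ : Finset ℚ} {N p : ℕ}
  {ι : E →ₗ[Cb] Xi Λ N p}

/-- Induction on the number of nonzero coordinates: `fᵢ(x) a x - fᵢ(a x) x` loses the `i`-th one and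
gains none, so its logarithmic derivative vanishes. If that of `x` did not, all ratios `fᵢ(a
x)/fᵢ(x)` would coincide and `a x` would be proportional to `x`, which excludes logarithms. -/
theorem logD_eq_zero_of_coordinates (ha : ∀ x, ι (ABAction.a x) = ABAction.a (ι x)) {n : ℕ}
    (f : E →ₗ[Cb] (Fin n → Cb)) (hf : Function.Injective f)
    (hfa : ∀ x i, f x i = 0 → f (ABAction.a x) i = 0) (x : E) : Xi.logD Λ N p (ι x) = 0 := by
  classical
  induction hm : (Finset.univ.filter fun i => f x i ≠ 0).card using Nat.strong_induction_on
    generalizing x with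
  | _ m ih =>
    by_contra hD
    have hrel : ∀ i, f x i ≠ 0 → f x i • Xi.logD Λ N p (ι (ABAction.a x)) =
        f (ABAction.a x) i • Xi.logD Λ N p (ι x) := by
      intro i hi
      have := ih _ ?_ (f x i • ABAction.a x - f (ABAction.a x) i • x) rfl
      · rwa [map_sub, map_smul, map_smul, map_sub, map_smul, map_smul, sub_eq_zero] at this
      · rw [← hm]
        refine Finset.card_lt_card (Finset.ssubset_iff_of_subset ?_ |>.2 ⟨i, by simpa using hi, ?_⟩)
        · intro k hk
          simp only [Finset.mem_filter, Finset.mem_univ, true_and] at hk ⊢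
          intro h0
          refine hk ?_
          simp [h0, hfa x k h0]
        · simp [mul_comm]
    obtain ⟨i, hi⟩ : ∃ i, f x i ≠ 0 := by
      by_contra! hcon
      have : x = 0 := hf (by rw [map_zero]; exact funext hcon)
      exact hD (by rw [this, map_zero, map_zero])
    have hx : f x i • ABAction.a x = f (ABAction.a x) i • x := by
      apply hf
      funext k
      simp only [map_smul, Pi.smul_apply, smul_eq_mul]
      by_cases hk : f x k = 0
      · rw [hk, hfa x k hk, mul_zero, mul_zero]
      · have h1 := congrArg (fun z => f x k • z) (hrel i hi)
        have h2 := congrArg (fun z => f x i • z) (hrel k hk)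
        simp only [← mul_smul] at h1 h2
        rw [mul_comm, h2] at h1
        have h3 := sub_eq_zero.2 h1
        rw [← sub_smul] at h3
        have := (smul_eq_zero.1 h3).resolve_right hD
        linear_combination this
    refine hD (Xi.logD_eq_zero_of_smul hi (S := f (ABAction.a x) i) ?_)
    rw [← ha, ← map_smul, hx, map_smul]

theorem logD_eq_zero_of_semisimple (ha : ∀ x, ι (ABAction.a x) = ABAction.a (ι x))
    (h : IsSemisimpleAB E) (x : E) : Xi.logD Λ N p (ι x) = 0 := by
  obtain ⟨-, n, M, _, _, _, hM, f, hf, hfa⟩ := h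
  have hg : ∀ i, Nonempty (M i ≃ₗ[Cb] Cb) := fun i => by
    obtain ⟨⟨⟨h1, h2⟩, -⟩, h3⟩ := hM i
    exact ⟨LinearEquiv.ofFinrankEq _ _ (by rw [h3, Module.finrank_self])⟩
  let g : ∀ i, M i ≃ₗ[Cb] Cb := fun i => Classical.choice (hg i)
  refine logD_eq_zero_of_coordinates ha ((LinearEquiv.piCongrRight g).toLinearMap ∘ₗ f)
    ((LinearEquiv.piCongrRight g).injective.comp hf) (fun x i h0 => ?_) x
  have h0' : g i (f x i) = 0 := h0
  change g i (f (ABAction.a x) i) = 0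
  rw [LinearEquiv.map_eq_zero_iff] at h0' ⊢
  rw [hfa]
  change ABAction.a (f x i) = 0
  rw [h0', map_zero]

theorem isABModule_of_injective (hι : Function.Injective ι) : IsABModule E :=
  ⟨Module.Free.of_equiv (LinearEquiv.ofInjective ι hι).symm, finite_of_injective hι⟩

theorem isRegularAB_Elam (ν : ℂ) : IsRegularAB (Elam ν) ∧ Module.finrank Cb (Elam ν) = 1 := by
  have h : IsABModule (Elam ν) :=
    ⟨inferInstanceAs (Module.Free Cb Cb), inferInstanceAs (Module.Finite Cb Cb)⟩
  refine ⟨⟨h, Elam ν, _, _, _, h, fun (x : Cb) => ?_, LinearMap.id, fun _ _ h => h, fun _ => rfl⟩,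
    Module.finrank_self Cb⟩
  refine ⟨(PowerSeries.C ν * x + bb * bderiv x : Cb), ?_⟩
  change PowerSeries.C ν * bb * x + bb ^ 2 * bderiv x =
    bb * (PowerSeries.C ν * x + bb * bderiv x : Cb)
  ring

/-- Only the coefficients of `(Log s)⁰` remain, and each one is a coordinate in some `E_r`. -/
theorem semisimple_of_logD_eq_zero (hι : Function.Injective ι)
    (ha : ∀ x, ι (ABAction.a x) = ABAction.a (ι x)) (h : ∀ x, Xi.logD Λ N p (ι x) = 0) :
    IsSemisimpleAB E := by
  let σ := Fintype.equivFin (Λ × Fin p)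
  let M : Fin (Fintype.card (Λ × Fin p)) → Type := fun i => Elam (((σ.symm i).1 : ℚ) : ℂ)
  refine ⟨isABModule_of_injective hι, _, M, _, _, _, fun i => isRegularAB_Elam _,
    { toFun := fun x i => ι x (σ.symm i).1 0 (σ.symm i).2
      map_add' := fun x y => by rw [map_add]; rfl
      map_smul' := fun S x => by rw [map_smul]; rfl }, fun x y hxy => hι ?_, fun x => ?_⟩
  · ext1 r j q
    rcases eq_or_ne j 0 with rfl | hj
    · have := congrFun hxy (σ (r, q))
      change ι x (σ.symm (σ (r, q))).1 0 (σ.symm (σ (r, q))).2 =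
        ι y (σ.symm (σ (r, q))).1 0 (σ.symm (σ (r, q))).2 at this
      rwa [Equiv.symm_apply_apply] at this
    · rw [Xi.apply_eq_zero_of_logD (h x) r hj q, Xi.apply_eq_zero_of_logD (h y) r hj q]
  · funext i
    change ι (ABAction.a x) (σ.symm i).1 0 (σ.symm i).2 =
      PowerSeries.C (((σ.symm i).1 : ℚ) : ℂ) * bb * ι x (σ.symm i).1 0 (σ.symm i).2 +
        bb ^ 2 * bderiv (ι x (σ.symm i).1 0 (σ.symm i).2)
    rw [ha, Xi.a_eq, Xi.theta_eq, h, add_zero, Xi.smul_apply, Xi.euler_apply]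
    ring

theorem ABSubmodule.generates_generate (x : E) :
    Generates x (ABSubmodule.generate {x}).toSubmodule :=
  ⟨Submodule.mem_sInf.2 fun _ hp => hp.1 rfl, fun _ hp hst =>
    sInf_le ⟨Set.singleton_subset_iff.2 hp, hst⟩⟩

/-- The kernel of `∂/∂Log s` is stable, so it contains everything generated by elements with
semi-simple cyclic submodule. Conversely the cyclic submodule of an element of the kernel stays in
it and has no logarithms. -/
theorem mem_semisimplePart (hι : Function.Injective ι)
    (ha : ∀ x, ι (ABAction.a x) = ABAction.a (ι x)) (x : E) :
    x ∈ (semisimplePart E).toSubmodule ↔ Xi.logD Λ N p (ι x) = 0 := by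
  have hst : ∀ y ∈ LinearMap.ker (Xi.logD Λ N p ∘ₗ ι),
      ABAction.a y ∈ LinearMap.ker (Xi.logD Λ N p ∘ₗ ι) := fun y hy => by
    rw [LinearMap.mem_ker, LinearMap.comp_apply] at hy ⊢
    rw [ha, Xi.logD_a, hy, map_zero]
  constructor
  · intro hx
    refine (Submodule.mem_sInf.1 hx) (LinearMap.ker (Xi.logD Λ N p ∘ₗ ι)) ⟨fun y hy => ?_, hst⟩
    exact logD_eq_zero_of_semisimple
      (ι := ι ∘ₗ (ABSubmodule.generate {y}).toSubmodule.subtype) (fun z => ha z) hy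
      ⟨y, (ABSubmodule.generates_generate y).1⟩
  · intro hx
    refine Submodule.mem_sInf.2 fun q hq => hq.1 ?_
    refine semisimple_of_logD_eq_zero
      (ι := ι ∘ₗ (ABSubmodule.generate {x}).toSubmodule.subtype)
      (hι.comp Subtype.val_injective) (fun z => ha z) fun z => ?_
    exact (ABSubmodule.generates_generate x).2 _ hx hst z.2

theorem Generates.top {F : ABSubmodule E} {x : E} (h : Generates x F.toSubmodule) :
    Generates (⟨x, h.1⟩ : F) ⊤ := by
  refine ⟨trivial, fun q hq hst y _ => ?_⟩
  obtain ⟨z, hz, hzy⟩ := h.2 (q.map F.toSubmodule.subtype) ⟨_, hq, rfl⟩ (by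
    rintro _ ⟨z, hz, rfl⟩
    exact ⟨_, hst z hz, rfl⟩) y.2
  rwa [← Subtype.ext hzy]

theorem exists_generates_semisimplePart (hι : Function.Injective ι)
    (ha : ∀ x, ι (ABAction.a x) = ABAction.a (ι x)) {e : E} (he : Generates e ⊤) :
    ∃ f : semisimplePart E, Generates f ⊤ := by
  obtain ⟨f, hf⟩ := exists_generates_ker (Xi.logD Λ N p ∘ₗ ι) (fun x => by
    rw [LinearMap.comp_apply, LinearMap.comp_apply, ha, Xi.logD_a]) he
  have : LinearMap.ker (Xi.logD Λ N p ∘ₗ ι) = (semisimplePart E).toSubmodule := by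
    ext x
    rw [mem_semisimplePart hι ha]
    rfl
  rw [this] at hf
  exact ⟨_, hf.top⟩

end SemisimplePart

/-! ### Normal submodules of rank 1 and primitive eigenvectors -/

section RankOne

variable {E : Type*} [AddCommGroup E] [Module Cb E] [ABAction E] {Λ : Finset ℚ} {N p : ℕ}
  {ι : E →ₗ[Cb] Xi Λ N p}

theorem isTorsionFree_of_injective (hι : Function.Injective ι) : Module.IsTorsionFree Cb E :=
  hι.moduleIsTorsionFree ι (map_smul ι)

theorem abIso_Elam [Module.IsTorsionFree Cb E] {ν : ℂ} {L : ABSubmodule E} {x : E}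
    (hx : ABAction.a x = (PowerSeries.C ν * bb) • x) (hx0 : x ≠ 0)
    (hL : L.toSubmodule = Submodule.span Cb {x}) : ABIso L (Elam ν) := by
  have hxL : x ∈ L.toSubmodule := hL ▸ Submodule.mem_span_singleton_self x
  let g : Elam ν →ₗ[Cb] L.toSubmodule := LinearMap.toSpanSingleton Cb L.toSubmodule ⟨x, hxL⟩
  have hg : ∀ S : Cb, ((g S : L.toSubmodule) : E) = S • x := fun S => rfl
  have hinj : Function.Injective g := by
    intro (S : Cb) (T : Cb) h
    have h1 : S • x = T • x := congrArg Subtype.val h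
    rw [← sub_eq_zero, ← sub_smul] at h1
    exact sub_eq_zero.1 ((smul_eq_zero.1 h1).resolve_right hx0)
  have hsurj : Function.Surjective g := by
    rintro ⟨y, hy⟩
    obtain ⟨S, rfl⟩ := Submodule.mem_span_singleton.1 (hL ▸ hy)
    exact ⟨S, rfl⟩
  have hga : ∀ S, g (ABAction.a S) = ABAction.a (g S) := by
    intro (S : Cb)
    apply Subtype.ext
    change (PowerSeries.C ν * bb * S + bb ^ 2 * bderiv S) • x = ABAction.a (S • x)
    rw [ABAction.a_smul, hx, ← mul_smul, ← add_smul]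
    congr 1
    ring
  let G := LinearEquiv.ofBijective g ⟨hinj, hsurj⟩
  refine ⟨G.symm, fun y => ?_⟩
  rw [LinearEquiv.symm_apply_eq]
  change _ = g _
  rw [hga]
  congr 1
  exact (G.apply_symm_apply y).symm

theorem ABSubmodule.IsNormal.generator_notMem [Module.IsTorsionFree Cb E] {L : ABSubmodule E}
    (hn : L.IsNormal) {x : E} (hx0 : x ≠ 0) (hL : L.toSubmodule = Submodule.span Cb {x}) :
    ¬ ∃ z, x = bb • z := by
  rintro ⟨z, hz⟩
  have hmem : x ∈ (L.toSubmodule : Set E) ∩ Set.range (fun x : E => bb • x) :=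
    ⟨hL ▸ Submodule.mem_span_singleton_self x, z, hz.symm⟩
  rw [hn] at hmem
  obtain ⟨y, hy, hyx⟩ := hmem
  obtain ⟨S, rfl⟩ := Submodule.mem_span_singleton.1 (hL ▸ hy)
  have h1 : (bb * S - 1) • x = 0 := by
    rw [sub_smul, mul_smul, one_smul, sub_eq_zero]; exact hyx
  have h2 := congrArg PowerSeries.constantCoeff ((smul_eq_zero.1 h1).resolve_right hx0)
  simp at h2

theorem exists_eigenvector_of_abIso [Module.IsTorsionFree Cb E] {ν : ℂ} {L : ABSubmodule E}
    (hn : L.IsNormal) (h : ABIso L (Elam ν)) :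
    ∃ x : E, ABAction.a x = (PowerSeries.C ν * bb) • x ∧ ¬ ∃ z, x = bb • z := by
  obtain ⟨φ, hφ⟩ := h
  let one : Elam ν := (1 : Cb)
  set x := φ.symm one with hx
  have hφx : φ x = one := φ.apply_symm_apply _
  have hax : ABAction.a x = (PowerSeries.C ν * bb) • x := by
    apply φ.injective
    rw [hφ, map_smul, hφx]
    change PowerSeries.C ν * bb * (1 : Cb) + bb ^ 2 * bderiv 1 = PowerSeries.C ν * bb * (1 : Cb)
    simp [bderiv]
  refine ⟨x, congrArg Subtype.val hax, hn.generator_notMem ?_ ?_⟩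
  · intro h0
    have : x = 0 := Subtype.ext h0
    rw [this, map_zero] at hφx
    exact zero_ne_one (α := Cb) hφx
  · apply le_antisymm
    · intro y hy
      let S : Cb := φ ⟨y, hy⟩
      refine Submodule.mem_span_singleton.2 ⟨S, ?_⟩
      have : S • x = ⟨y, hy⟩ := by
        apply φ.injective
        rw [map_smul, hφx]
        exact mul_one S
      exact congrArg Subtype.val this
    · rw [Submodule.span_singleton_le_iff_mem]
      exact x.2

/-- A basis vector satisfies `a x = g x`; its expansion in `Ξ` supplies the unit that turns `g` into
`ν b`. -/
theorem exists_abIso_of_finrank_eq_one (hι : Function.Injective ι)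
    (ha : ∀ x, ι (ABAction.a x) = ABAction.a (ι x)) {L : ABSubmodule E}
    (h : Module.finrank Cb L = 1) : ∃ ν : ℂ, ABIso L (Elam ν) := by
  have := isTorsionFree_of_injective hι
  obtain ⟨h1, h2⟩ := isABModule_of_injective (E := L) (ι := ι ∘ₗ L.toSubmodule.subtype)
    (hι.comp Subtype.val_injective)
  let φ : L ≃ₗ[Cb] Cb := LinearEquiv.ofFinrankEq _ _ (by rw [h, Module.finrank_self])
  set x : L := φ.symm 1
  have hφx : φ x = 1 := φ.apply_symm_apply _
  have hgen : ∀ y : L, y = φ y • x := fun y => φ.injective (by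
    rw [map_smul, hφx, smul_eq_mul, mul_one])
  have hx0 : (x : E) ≠ 0 := by
    intro h0
    have : x = 0 := Subtype.ext h0
    rw [this, map_zero] at hφx
    exact zero_ne_one hφx
  have hax : ABAction.a (x : E) = φ (ABAction.a x) • (x : E) :=
    congrArg Subtype.val (hgen (ABAction.a x))
  obtain ⟨ν, u, hu, hν⟩ := Xi.exists_normalized (x := ι x) ((map_ne_zero_iff ι hι).2 hx0)
    (g := φ (ABAction.a x)) (by rw [← ha, hax, map_smul])
  refine ⟨ν, abIso_Elam (hν _ hax) (smul_ne_zero hu.ne_zero hx0) ?_⟩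
  rw [Submodule.span_singleton_smul_eq hu]
  apply le_antisymm
  · intro y hy
    exact Submodule.mem_span_singleton.2 ⟨_, (congrArg Subtype.val (hgen ⟨y, hy⟩)).symm⟩
  · rw [Submodule.span_singleton_le_iff_mem]
    exact x.2

theorem exists_normal_of_eigenvector [Module.IsTorsionFree Cb E] {ν : ℂ} {x : E}
    (hx : ABAction.a x = (PowerSeries.C ν * bb) • x) (hx0 : ¬ ∃ z, x = bb • z) :
    ∃ L : ABSubmodule E, L.IsNormal ∧ Module.finrank Cb L = 1 ∧ ABIso L (Elam ν) := by
  have hxne : x ≠ 0 := fun h => hx0 ⟨0, by rw [h, smul_zero]⟩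
  obtain ⟨L, hL⟩ : ∃ L : ABSubmodule E, L.toSubmodule = Submodule.span Cb {x} :=
    ⟨{  toSubmodule := Submodule.span Cb {x}
        a_mem := fun y hy => by
          obtain ⟨S, rfl⟩ := Submodule.mem_span_singleton.1 hy
          rw [ABAction.a_smul, hx, ← mul_smul, ← add_smul]
          exact Submodule.smul_mem _ _ (Submodule.mem_span_singleton_self x) }, rfl⟩
  have hiso : ABIso L (Elam ν) := abIso_Elam hx hxne hL
  refine ⟨L, ?_, ?_, hiso⟩
  · rw [ABSubmodule.IsNormal, hL]
    apply Set.Subset.antisymm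
    · rintro _ ⟨hy, z, rfl⟩
      obtain ⟨S, hS⟩ := Submodule.mem_span_singleton.1 hy
      have hd : bb ∣ S := by
        rw [PowerSeries.X_dvd_iff]
        by_contra hne
        obtain ⟨u, rfl⟩ : IsUnit S := PowerSeries.isUnit_iff_constantCoeff.2 (Ne.isUnit hne)
        refine hx0 ⟨(↑u⁻¹ : Cb) • z, ?_⟩
        rw [smul_comm]
        change x = (↑u⁻¹ : Cb) • (fun x : E => bb • x) z
        rw [← hS, ← mul_smul, Units.inv_mul, one_smul]
      obtain ⟨T, rfl⟩ := hd
      exact ⟨T • x, Submodule.smul_mem _ _ (Submodule.mem_span_singleton_self x), by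
        rw [← hS, mul_smul]⟩
    · rintro _ ⟨y, hy, rfl⟩
      exact ⟨Submodule.smul_mem _ _ hy, y, rfl⟩
  · obtain ⟨φ, -⟩ := hiso
    exact φ.finrank_eq.trans (Module.finrank_self Cb)

end RankOne

/-! ### Comparison of a fresco with its semi-simple part -/

theorem IsFresco.exists_embedding {E : Type*} [AddCommGroup E] [Module Cb E] [ABAction E]
    (hE : IsFresco E) : ∃ (Λ : Finset ℚ) (N p : ℕ) (ι : E →ₗ[Cb] Xi Λ N p) (e : E),
      Function.Injective ι ∧ (∀ x, ι (ABAction.a x) = ABAction.a (ι x)) ∧ Generates e ⊤ := by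
  obtain ⟨Λ, N, p, φ, -, g, hg⟩ := hE
  have hφ := (ABSubmodule.generates_generate φ).top
  refine ⟨Λ, N, p, (ABSubmodule.generate {φ}).toSubmodule.subtype ∘ₗ g.toLinearMap, 
    g.symm ⟨φ, (ABSubmodule.generates_generate φ).1⟩,
    Subtype.val_injective.comp g.injective, fun x => congrArg Subtype.val (hg x), trivial,
    fun q hq hst y _ => ?_⟩
  have hle := hφ.2 (q.map g.toLinearMap) ⟨_, hq, g.apply_symm_apply _⟩ (by
    rintro _ ⟨z, hz, rfl⟩
    exact ⟨_, hst z hz, hg z⟩)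
  obtain ⟨z, hz, hzy⟩ := hle (trivial : g y ∈ _)
  rwa [← g.injective hzy]

theorem mainTheorem10 {E : Type*} [AddCommGroup E] [Module Cb E] [ABAction E]
    (hE : IsFresco E)
    (k : ℕ) (F : ℕ → ABSubmodule E) (lam : ℕ → ℂ) (hF : IsJordanHolder k F lam)
    (d : ℕ) (G : ℕ → ABSubmodule (semisimplePart E)) (mu : ℕ → ℂ)
    (hG : IsJordanHolder d G mu) :
    (∀ j ∈ Finset.Icc 1 k,
      (∃ L : ABSubmodule E, L.IsNormal ∧ Module.finrank Cb L = 1 ∧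
          ABIso L (Elam (lam j + (j : ℂ) - 1))) ↔
        ∃ i ∈ Finset.Icc 1 d, lam j + (j : ℂ) - 1 = mu i + (i : ℂ) - 1) ∧
    (∀ L : ABSubmodule E, L.IsNormal → Module.finrank Cb L = 1 →
      ∃ j ∈ Finset.Icc 1 k, ABIso L (Elam (lam j + (j : ℂ) - 1)) ∧
        ∃ i ∈ Finset.Icc 1 d, lam j + (j : ℂ) - 1 = mu i + (i : ℂ) - 1) := by
  obtain ⟨Λ, N, p, ι, e, hι, ha, he⟩ := hE.exists_embedding
  have := isTorsionFree_of_injective hι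
  obtain ⟨f, hf⟩ := exists_generates_semisimplePart hι ha he
  set κ := ι ∘ₗ (semisimplePart E).toSubmodule.subtype with hκdef
  have hκ : Function.Injective κ := hι.comp Subtype.val_injective
  have hκa : ∀ x, κ (ABAction.a x) = ABAction.a (κ x) := fun x => ha x
  have hmu : ∀ (L : ABSubmodule E) (ν : ℂ), L.IsNormal → ABIso L (Elam ν) →
      ∃ i ∈ Finset.Icc 1 d, ν = mu i + (i : ℂ) - 1 := by
    intro L ν hn hL
    obtain ⟨x, hx, hx0⟩ := exists_eigenvector_of_abIso hn hL
    -- An eigenvector carries no logarithm, so the exponent can be read on a J-H. sequence of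
    -- `S₁(E)`.
    have hxS : x ∈ (semisimplePart E).toSubmodule := by
      rw [mem_semisimplePart hι ha]
      refine Xi.logD_eq_zero_of_smul one_ne_zero (S := PowerSeries.C ν * bb) ?_
      rw [one_smul, ← ha, hx, map_smul]
    exact hG.exists_eq_of_eigenvector hκ hκa hf (x := ⟨x, hxS⟩) (Subtype.ext hx)
      fun ⟨z, hz⟩ => hx0 ⟨z, congrArg Subtype.val hz⟩
  refine ⟨fun j _ => ⟨fun ⟨L, hn, _, hL⟩ => hmu L _ hn hL, ?_⟩, fun L hn hrk => ?_⟩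
  · rintro ⟨i, hi, hij⟩
    obtain ⟨x, hx, hx0⟩ := hG.exists_eigenvector hκ hκa hf
      ((mem_semisimplePart hι ha f).1 f.2) hi
    rw [hij]
    refine exists_normal_of_eigenvector (x := (x : E)) (congrArg Subtype.val hx) ?_
    rintro ⟨z, hz⟩
    -- `S₁(E)` is saturated for `b`, being the kernel of a map to a torsion-free module; so
    -- primitive in `S₁(E)` implies primitive in `E`.
    have hzS : z ∈ (semisimplePart E).toSubmodule := by
      rw [mem_semisimplePart hι ha]
      have h := (mem_semisimplePart hι ha x).1 x.2
      rw [hz, map_smul, map_smul] at h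
      exact (smul_eq_zero.1 h).resolve_left PowerSeries.X_ne_zero
    exact hx0 ⟨⟨z, hzS⟩, Subtype.ext hz⟩
  · obtain ⟨ν, hL⟩ := exists_abIso_of_finrank_eq_one hι ha hrk
    obtain ⟨x, hx, hx0⟩ := exists_eigenvector_of_abIso hn hL
    obtain ⟨j, hj, rfl⟩ := hF.exists_eq_of_eigenvector hι ha he hx hx0
    exact ⟨j, hj, hL, hmu L _ hn hL⟩
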